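/- Let $K$ be a field. An arrangement in a finite-dimensional $K$-vector space $V$ is a finite set $\mathcal A$ of linear hyperplanes of $V$ (all arrangements are simple and central). Let $S=S(V^*)$ be the symmetric algebra of $V^*$, and for each $H\in\mathcal A$ let $\alpha_H\in V^*$ be a linear form with $H=\ker\alpha_H$. The arrangement $\mathcal A$ is free if the $S$-module $$D(\mathcal A)=\{\theta\in\mathrm{Der}_K(S)\mid \theta(\alpha_H)\in\alpha_H S\ \text{ for all } H\in\mathcal A\}$$ has a basis of homogeneous derivations; the multiset of polynomial degrees of such a basis is then denoted by $\exp\mathcal A$. (Here $\theta$ has polynomial degree $p$ if $\theta(x)$ is zero or homogeneous of degree $p$ for all $x\in V^*$.) For $H\in\mathcal A$ put $\mathcal A'=\mathcal A\setminus\{H\}$, an arrangement in $V$, and $\mathcal A''=\{H\cap H'\mid H'\in\mathcal A'\}$, an arrangement in $H$. The class $\mathcal{RF}$ of recursively free arrangements is the smallest class of arrangements (in finite-dimensional $K$-vector spaces) such that: 1. the empty arrangement in each finite-dimensional $V$ belongs to $\mathcal{RF}$; 2. if for some $H\in\mathcal A$ both $\mathcal A'$ and $\mathcal A''$ belong to $\mathcal{RF}$,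 are free, and $\exp\mathcal A''\subseteq\exp\mathcal A'$, then $\mathcal A\in\mathcal{RF}$; 3. if for some $H\in\mathcal A$ both $\mathcal A$ and $\mathcal A''$ belong to $\mathcal{RF}$, are free, and $\exp\mathcal A''\subseteq\exp\mathcal A$, then $\mathcal A'\in\mathcal{RF}$. **Theorem 1.2.** Let $\mathcal A_1$ and $\mathcal A_2$ be arrangements in finite-dimensional $K$-vector spaces $V_1$ and $V_2$. Then the product $$\mathcal A_1\times\mathcal A_2=\{H_1\oplus V_2\mid H_1\in\mathcal A_1\}\cup\{V_1\oplus H_2\mid H_2\in\mathcal A_2\},$$ an arrangement in $V_1\oplus V_2$, is recursively free if and only if both $\mathcal A_1$ and $\mathcal A_2$ are recursively free. -/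

import Mathlib

universe u v

/-- A (central) hyperplane arrangement in the `K`-vector space `V`: a finite set of linear
hyperplanes, i.e. of kernels of nonzero linear forms on `V`. -/
@[ext]
structure Arrangement (K : Type u) [Field K] (V : Type v) [AddCommGroup V] [Module K V] where
  /-- the set of hyperplanes of the arrangement -/
  hyperplanes : Set (Submodule K V)
  finite : hyperplanes.Finite
  isHyperplane : ∀ H ∈ hyperplanes, ∃ α : Module.Dual K V, α ≠ 0 ∧ H = LinearMap.ker α

namespace Arrangement

section Operations

variable {K : Type u} [Field K] {V : Type v} [AddCommGroup V] [Module K V]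

variable (K V) in
/-- The empty arrangement in `V`. -/
def empty : Arrangement K V where
  hyperplanes := ∅
  finite := Set.finite_empty
  isHyperplane := fun _ h => h.elim

/-- The deletion `A' = A \ {H}`. -/
def deletion (A : Arrangement K V) (H : Submodule K V) : Arrangement K V where
  hyperplanes := A.hyperplanes \ {H}
  finite := A.finite.subset Set.sdiff_subset
  isHyperplane := fun H' h => A.isHyperplane H' h.1

/-- The restriction `A^X = {X ∩ H' | H' ∈ A, X ⊄ H'}`, an arrangement in the subspace `X`. For a
hyperplane `X = H` of `A` this is the arrangement `A''` of the triple `(A, A', A'')`. -/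
def restriction (A : Arrangement K V) (X : Submodule K V) : Arrangement K X where
  hyperplanes := (fun H' => H'.comap X.subtype) '' {H' ∈ A.hyperplanes | ¬ X ≤ H'}
  finite := (A.finite.subset (Set.sep_subset _ _)).image _
  isHyperplane := by
    rintro _ ⟨H', ⟨hH', hX⟩, rfl⟩
    obtain ⟨α, -, rfl⟩ := A.isHyperplane H' hH'
    refine ⟨α ∘ₗ X.subtype, fun h => hX fun x hx => ?_, rfl⟩
    exact LinearMap.congr_fun h ⟨x, hx⟩

/-- The product `A₁ × A₂ = {H₁ ⊕ V₂ | H₁ ∈ A₁} ∪ {V₁ ⊕ H₂ | H₂ ∈ A₂}` in `V₁ ⊕ V₂`. -/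
def prod {V₁ V₂ : Type v} [AddCommGroup V₁] [Module K V₁] [AddCommGroup V₂] [Module K V₂]
    (A₁ : Arrangement K V₁) (A₂ : Arrangement K V₂) : Arrangement K (V₁ × V₂) where
  hyperplanes := (fun H₁ : Submodule K V₁ => H₁.prod (⊤ : Submodule K V₂)) '' A₁.hyperplanes ∪
    (fun H₂ : Submodule K V₂ => (⊤ : Submodule K V₁).prod H₂) '' A₂.hyperplanes
  finite := (A₁.finite.image _).union (A₂.finite.image _)
  isHyperplane := by
    rintro _ (⟨H, hH, rfl⟩ | ⟨H, hH, rfl⟩)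
    · obtain ⟨α, hα, rfl⟩ := A₁.isHyperplane H hH
      refine ⟨α ∘ₗ LinearMap.fst K V₁ V₂, fun h => hα (LinearMap.ext fun x => ?_), ?_⟩
      · exact LinearMap.congr_fun h (x, 0)
      · ext x
        simp
    · obtain ⟨α, hα, rfl⟩ := A₂.isHyperplane H hH
      refine ⟨α ∘ₗ LinearMap.snd K V₁ V₂, fun h => hα (LinearMap.ext fun x => ?_), ?_⟩
      · exact LinearMap.congr_fun h (0, x)
      · ext x
        simp

end Operations

section Derivations

variable (K : Type u) [Field K] (V : Type v) [AddCommGroup V] [Module K V]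

/-- The symmetric algebra `S = S(V*)` of the dual space, i.e. the ring of polynomials on `V`. -/
def Poly : Type (max u v) := SymmetricAlgebra K (Module.Dual K V)

noncomputable instance Poly.instCommRing : CommRing (Poly K V) :=
  inferInstanceAs (CommRing (SymmetricAlgebra K (Module.Dual K V)))

noncomputable instance Poly.instAlgebra : Algebra K (Poly K V) :=
  inferInstanceAs (Algebra K (SymmetricAlgebra K (Module.Dual K V)))

/-- The inclusion `V* → S` of the linear forms into `S`. -/
noncomputable def Poly.form : Module.Dual K V →ₗ[K] Poly K V :=
  SymmetricAlgebra.ι K (Module.Dual K V)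

/-- `S` with the inclusion of `V*` is the symmetric algebra in the sense of Mathlib. -/
theorem Poly.isSymmetricAlgebra_form : IsSymmetricAlgebra (Poly.form K V) :=
  SymmetricAlgebra.isSymmetricAlgebra_ι

/-- The module `Der(S)` of `K`-derivations of `S`. -/
abbrev Der : Type (max u v) := Derivation K (Poly K V) (Poly K V)

/-- The space `S_p` of homogeneous polynomials of degree `p` (along with `0`): the span of the
`p`-fold products of linear forms. -/
noncomputable def homogeneousPart (p : ℕ) : Submodule K (Poly K V) :=
  LinearMap.range (Poly.form K V) ^ p

variable {K V}

/-- `θ` is homogeneous of polynomial degree `p`: in the coordinates `x₁, …, x_ℓ` given by any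
basis of `V*` one has `θ = ∑ θ(x_i) ∂/∂x_i` with all `θ(x_i)` in `S_p`. -/
def IsHomogeneousDer (θ : Der K V) (p : ℕ) : Prop :=
  ∀ x : Module.Dual K V, θ (Poly.form K V x) ∈ homogeneousPart K V p

/-- The module `D(A)` of `A`-derivations: all `θ ∈ Der(S)` with `θ(α_H) ∈ α_H S` for each `H ∈ A`.
A linear form `α` with kernel `H` is unique up to a nonzero scalar, so that
quantifying over all of them is the same as fixing one. -/
noncomputable def derivations (A : Arrangement K V) : Submodule (Poly K V) (Der K V) where
  carrier := {θ | ∀ α : Module.Dual K V, LinearMap.ker α ∈ A.hyperplanes →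
    θ (Poly.form K V α) ∈ Ideal.span {Poly.form K V α}}
  add_mem' := fun h₁ h₂ α hα => by
    rw [Derivation.add_apply]
    exact Ideal.add_mem _ (h₁ α hα) (h₂ α hα)
  zero_mem' := fun α _ => by
    rw [Derivation.zero_apply]
    exact Ideal.zero_mem _
  smul_mem' := fun s θ h α hα => by
    rw [Derivation.smul_apply, smul_eq_mul]
    exact Ideal.mul_mem_left _ s (h α hα)

/-- `A` is free with multiset of exponents `e`: the `S`-module `D(A)` has a basis of homogeneous
derivations whose polynomial degrees form the multiset `e`. -/
def IsFreeWithExponents (A : Arrangement K V) (e : Multiset ℕ) : Prop :=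
  ∃ (ι : Type) (_ : Fintype ι) (θ : Module.Basis ι (Poly K V) A.derivations) (d : ι → ℕ),
    (∀ i, IsHomogeneousDer (θ i : Der K V) (d i)) ∧ e = Finset.univ.val.map d

/-- `exp A ⊆ exp B`, an inclusion of multisets of exponents of free arrangements (the exponents of
a free arrangement are unique). -/
def ExponentsSubset {W : Type v} [AddCommGroup W] [Module K W]
    (A : Arrangement K V) (B : Arrangement K W) : Prop :=
  ∃ a b : Multiset ℕ, A.IsFreeWithExponents a ∧ B.IsFreeWithExponents b ∧ a ≤ b

end Derivations

/-- The class of recursively free arrangements: the smallest class of arrangements in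
finite-dimensional `K`-vector spaces that contains the empty arrangements and is closed under
addition and deletion of a hyperplane `H` along triples `(A, A', A'')` with `exp A'' ⊆ exp A'`,
respectively `exp A'' ⊆ exp A`. -/
inductive IsRecursivelyFree {K : Type u} [Field K] :
    ∀ {V : Type v} [AddCommGroup V] [Module K V], Arrangement K V → Prop
  | empty {V : Type v} [AddCommGroup V] [Module K V] [FiniteDimensional K V] :
      IsRecursivelyFree (Arrangement.empty K V)
  | addition {V : Type v} [AddCommGroup V] [Module K V] [FiniteDimensional K V]
      (A : Arrangement K V) (H : Submodule K V) (hH : H ∈ A.hyperplanes)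
      (hdel : IsRecursivelyFree (A.deletion H)) (hres : IsRecursivelyFree (A.restriction H))
      (hexp : (A.restriction H).ExponentsSubset (A.deletion H)) :
      IsRecursivelyFree A
  | deletion {V : Type v} [AddCommGroup V] [Module K V] [FiniteDimensional K V]
      (A : Arrangement K V) (H : Submodule K V) (hH : H ∈ A.hyperplanes)
      (hA : IsRecursivelyFree A) (hres : IsRecursivelyFree (A.restriction H))
      (hexp : (A.restriction H).ExponentsSubset A) :
      IsRecursivelyFree (A.deletion H)

end Arrangement

/-! Both directions are inductions on the construction of a recursively free arrangement. A triple
`(A, A', A'')` can be localized or multiplied by a fixed arrangement, but the inclusion of exponents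
does not transfer directly. It is therefore traded for freeness: if `A` and `A'` are free, then
`A''` is free and its exponents are contained in those of both (`exponentsSubset_of_isFree`).
Conversely, Terao's addition and deletion theorems (`isFree_of_addition`, `isFree_of_deletion`) show
that every arrangement occurring in the construction is free. It then suffices that localizations
and products of free arrangements are free (`IsFree.push`, `IsFree.prod`).

From left to right: each factor is a localization of the product, namely its `push` along a
projection, and recursive freeness passes to localizations (`IsRecursivelyFree.push`). A hyperplane
containing the kernel gives a localized triple; deleting any other hyperplane leaves the
localization unchanged.

From right to left: induction on `A₁` multiplies each triple by `A₂`. This leaves the product of an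
empty arrangement with `A₂`, which after a swap of factors is handled by the same induction on `A₂`.

All freeness statements come from Saito's criterion: independent homogeneous elements of `D(A)`, as
many as `dim V`, form a basis as soon as their degrees add up to at most `|A|`. The other tool is
Terao's polynomial of degree `|A'| - |A''|`, which divides `θ(α_H)` on `H` for every `θ ∈ D(A')`. -/

namespace Arrangement

/-! ### Polynomial functions: pullback, grading, and linear forms as primes -/

section PolynomialRing

variable {K : Type u} [Field K] {V W U : Type v} [AddCommGroup V] [Module K V]
  [AddCommGroup W] [Module K W] [AddCommGroup U] [Module K U]

open Module Polynomial

instance Poly.instIsDomain : IsDomain (Poly K V) :=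
  inferInstanceAs (IsDomain (SymmetricAlgebra K (Module.Dual K V)))

/-- The algebra map out of the polynomial ring given by a linear map on linear forms. -/
noncomputable def Poly.lift {A : Type*} [CommRing A] [Algebra K A] (f : Dual K V →ₗ[K] A) :
    Poly K V →ₐ[K] A :=
  (Poly.isSymmetricAlgebra_form K V).lift f

@[simp]
theorem Poly.lift_form {A : Type*} [CommRing A] [Algebra K A] (f : Dual K V →ₗ[K] A)
    (α : Dual K V) : Poly.lift f (Poly.form K V α) = f α :=
  (Poly.isSymmetricAlgebra_form K V).lift_eq f α

theorem Poly.algHom_ext {A : Type*} [CommRing A] [Algebra K A] {f g : Poly K V →ₐ[K] A}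
    (h : ∀ α, f (Poly.form K V α) = g (Poly.form K V α)) : f = g :=
  (Poly.isSymmetricAlgebra_form K V).algHom_ext (LinearMap.ext h)

theorem Poly.induction {motive : Poly K V → Prop}
    (algebraMap : ∀ r, motive (algebraMap K (Poly K V) r))
    (form : ∀ α, motive (Poly.form K V α))
    (mul : ∀ a b, motive a → motive b → motive (a * b))
    (add : ∀ a b, motive a → motive b → motive (a + b)) (a : Poly K V) : motive a :=
  (Poly.isSymmetricAlgebra_form K V).induction algebraMap form mul add a

theorem Poly.form_eq_zero_iff {α : Dual K V} : Poly.form K V α = 0 ↔ α = 0 := by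
  refine ⟨fun h => LinearMap.ext fun v => ?_, fun h => by rw [h, map_zero]⟩
  have := congrArg (Poly.lift ((LinearMap.toSpanSingleton K K[X] X) ∘ₗ Dual.eval K V v)) h
  simpa [Polynomial.X_ne_zero] using this

/-- Composition of polynomial functions with a linear map. -/
noncomputable def Poly.pullback (f : V →ₗ[K] W) : Poly K W →ₐ[K] Poly K V :=
  Poly.lift (Poly.form K V ∘ₗ f.dualMap)

@[simp]
theorem Poly.pullback_form (f : V →ₗ[K] W) (β : Dual K W) :
    Poly.pullback f (Poly.form K W β) = Poly.form K V (β ∘ₗ f) := by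
  simp [Poly.pullback]; rfl

theorem Poly.pullback_pullback (f : V →ₗ[K] W) (g : W →ₗ[K] U) (s : Poly K U) :
    Poly.pullback f (Poly.pullback g s) = Poly.pullback (g ∘ₗ f) s := by
  have : (Poly.pullback f).comp (Poly.pullback g) = Poly.pullback (g ∘ₗ f) :=
    Poly.algHom_ext fun α => by simp [LinearMap.comp_assoc]
  exact DFunLike.congr_fun this s

@[simp]
theorem Poly.pullback_id (s : Poly K V) : Poly.pullback LinearMap.id s = s := by
  have : Poly.pullback (LinearMap.id : V →ₗ[K] V) = AlgHom.id K _ :=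
    Poly.algHom_ext fun α => by simp
  exact DFunLike.congr_fun this s

theorem Poly.pullback_injective {f : V →ₗ[K] W} {g : W →ₗ[K] V} (h : f ∘ₗ g = LinearMap.id) :
    Function.Injective (Poly.pullback f) := by
  refine Function.LeftInverse.injective (g := Poly.pullback g) fun s => ?_
  rw [Poly.pullback_pullback, h, Poly.pullback_id]

theorem form_mem_homogeneousPart (α : Dual K V) : Poly.form K V α ∈ homogeneousPart K V 1 := by
  rw [homogeneousPart, pow_one]
  exact ⟨α, rfl⟩

theorem mul_mem_homogeneousPart {p q : ℕ} {s t : Poly K V} (hs : s ∈ homogeneousPart K V p)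
    (ht : t ∈ homogeneousPart K V q) : s * t ∈ homogeneousPart K V (p + q) := by
  rw [homogeneousPart, pow_add]
  exact Submodule.mul_mem_mul hs ht

theorem algebraMap_mem_homogeneousPart (c : K) :
    algebraMap K (Poly K V) c ∈ homogeneousPart K V 0 := by
  rw [homogeneousPart, pow_zero]
  exact Submodule.mem_one.2 ⟨c, rfl⟩

theorem one_mem_homogeneousPart : (1 : Poly K V) ∈ homogeneousPart K V 0 := by
  simpa using algebraMap_mem_homogeneousPart (V := V) (1 : K)

theorem exists_of_mem_homogeneousPart_zero {s : Poly K V} (hs : s ∈ homogeneousPart K V 0) :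
    ∃ c : K, algebraMap K (Poly K V) c = s := by
  rw [homogeneousPart, pow_zero] at hs
  exact Submodule.mem_one.1 hs

theorem isUnit_of_mem_homogeneousPart_zero {s : Poly K V} (hs : s ∈ homogeneousPart K V 0)
    (h0 : s ≠ 0) : IsUnit s := by
  obtain ⟨c, rfl⟩ := exists_of_mem_homogeneousPart_zero hs
  exact (IsUnit.mk0 c fun h => h0 (by rw [h, map_zero])).map _

theorem prod_mem_homogeneousPart {ι : Type*} (s : Finset ι) (f : ι → Poly K V) (d : ι → ℕ)
    (h : ∀ i ∈ s, f i ∈ homogeneousPart K V (d i)) :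
    ∏ i ∈ s, f i ∈ homogeneousPart K V (∑ i ∈ s, d i) := by
  classical
  induction s using Finset.induction_on with
  | empty => simpa using one_mem_homogeneousPart
  | insert a s ha ih =>
    rw [Finset.prod_insert ha, Finset.sum_insert ha]
    exact mul_mem_homogeneousPart (h a (Finset.mem_insert_self a s))
      (ih fun i hi => h i (Finset.mem_insert_of_mem hi))

theorem pow_mem_homogeneousPart {s : Poly K V} {p : ℕ} (hs : s ∈ homogeneousPart K V p) (k : ℕ) :
    s ^ k ∈ homogeneousPart K V (k * p) := by
  simpa using prod_mem_homogeneousPart (Finset.range k) (fun _ => s) (fun _ => p) fun _ _ => hs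

theorem pullback_mem_homogeneousPart (f : V →ₗ[K] W) {p : ℕ} {s : Poly K W}
    (hs : s ∈ homogeneousPart K W p) : Poly.pullback f s ∈ homogeneousPart K V p := by
  have h : (homogeneousPart K W p).map (Poly.pullback f).toLinearMap ≤ homogeneousPart K V p := by
    rw [homogeneousPart, Submodule.map_pow]
    refine pow_le_pow_left' ?_ p
    rintro _ ⟨_, ⟨β, rfl⟩, rfl⟩
    exact ⟨β ∘ₗ f, (Poly.pullback_form f β).symm⟩
  exact h ⟨s, hs, rfl⟩

variable (K V) in
/-- The algebra map `S → S[t]` with `α ↦ α t` for linear forms `α`; it records the grading. -/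
noncomputable def gradeHom : Poly K V →ₐ[K] (Poly K V)[X] :=
  Poly.lift
    { toFun := fun α => C (Poly.form K V α) * X
      map_add' := fun a b => by simp [add_mul]
      map_smul' := fun c a => by
        rw [map_smul, RingHom.id_apply, ← smul_mul_assoc, Polynomial.smul_C] }

@[simp]
theorem gradeHom_form (α : Dual K V) :
    gradeHom K V (Poly.form K V α) = C (Poly.form K V α) * X := by
  simp [gradeHom]

theorem gradeHom_of_mem {p : ℕ} {s : Poly K V} (hs : s ∈ homogeneousPart K V p) :
    gradeHom K V s = C s * X ^ p := by
  refine Submodule.pow_induction_on_left' (LinearMap.range (Poly.form K V))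
    (C := fun n x _ => gradeHom K V x = C x * X ^ n) (fun r => ?_) (fun x y i _ _ hx hy => ?_)
    (fun m hm i x _ hx => ?_) hs
  · rw [AlgHom.commutes, pow_zero, mul_one]; rfl
  · rw [map_add, hx, hy, C_add, add_mul]
  · obtain ⟨α, rfl⟩ := hm
    rw [map_mul, hx, gradeHom_form, C_mul, pow_succ]
    ring

/-- The coefficients of `gradeHom` are the homogeneous components; setting `t = 1` recovers the
polynomial. -/
theorem coeff_gradeHom_mem (s : Poly K V) :
    ∀ p, (gradeHom K V s).coeff p ∈ homogeneousPart K V p := by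
  induction s using Poly.induction with
  | algebraMap r =>
    intro p
    rw [gradeHom_of_mem (algebraMap_mem_homogeneousPart r), coeff_C_mul, coeff_X_pow]
    split_ifs with h
    · rw [h, mul_one]; exact algebraMap_mem_homogeneousPart r
    · simp
  | form α =>
    intro p
    rw [gradeHom_of_mem (form_mem_homogeneousPart α), coeff_C_mul, coeff_X_pow]
    split_ifs with h
    · rw [h, mul_one]; exact form_mem_homogeneousPart α
    · simp
  | mul a b ha hb =>
    intro p
    rw [map_mul, coeff_mul]
    refine Submodule.sum_mem _ fun x hx => ?_
    rw [← Finset.HasAntidiagonal.mem_antidiagonal.1 hx]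
    exact mul_mem_homogeneousPart (ha _) (hb _)
  | add a b ha hb =>
    intro p
    rw [map_add, coeff_add]
    exact Submodule.add_mem _ (ha p) (hb p)

theorem eval_one_gradeHom (s : Poly K V) : (gradeHom K V s).eval 1 = s := by
  have : ((Polynomial.aeval (R := Poly K V) (1 : Poly K V)).restrictScalars K).comp
      (gradeHom K V) = AlgHom.id K _ := Poly.algHom_ext fun α => by simp
  simpa [Polynomial.aeval_def] using DFunLike.congr_fun this s

theorem mem_homogeneousPart_of_coeff {p : ℕ} {s : Poly K V}
    (h : ∀ k, k ≠ p → (gradeHom K V s).coeff k = 0) : s ∈ homogeneousPart K V p := by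
  have h1 : gradeHom K V s = C ((gradeHom K V s).coeff p) * X ^ p := by
    ext k
    rw [coeff_C_mul, coeff_X_pow]
    split_ifs with hk
    · rw [hk, mul_one]
    · rw [mul_zero, h k hk]
  have h2 := eval_one_gradeHom s
  rw [h1] at h2
  simp only [eval_mul, eval_C, eval_pow, eval_X, one_pow, mul_one] at h2
  rw [← h2]
  exact coeff_gradeHom_mem s p

/-- Cofactors of homogeneous polynomials are homogeneous. -/
theorem mem_homogeneousPart_of_mul {p q : ℕ} {s t : Poly K V} (hs : s ≠ 0) (ht : t ≠ 0)
    (hst : s * t ∈ homogeneousPart K V p) (htq : t ∈ homogeneousPart K V q) :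
    q ≤ p ∧ s ∈ homogeneousPart K V (p - q) := by
  have h := gradeHom_of_mem hst
  rw [map_mul, gradeHom_of_mem htq] at h
  -- Compare coefficients of `t ^ (k + q)`: only the component of `s` of degree `p - q` survives,
  -- since `S` is a domain.
  have hc : ∀ k, k + q ≠ p → (gradeHom K V s).coeff k = 0 := by
    intro k hk
    have := congrArg (fun f => f.coeff (k + q)) h
    simp only [← mul_assoc, coeff_mul_X_pow, coeff_mul_C, coeff_C_mul_X_pow, if_neg hk] at this
    exact (mul_eq_zero.1 this).resolve_right ht
  have hq : q ≤ p := by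
    by_contra hlt
    apply hs
    rw [← eval_one_gradeHom s]
    have : gradeHom K V s = 0 := by
      ext k
      simpa using hc k (by omega)
    rw [this, eval_zero]
  exact ⟨hq, mem_homogeneousPart_of_coeff fun k hk => hc k (by omega)⟩

/-- A splitting `V = W ⊕ K v` along the hyperplane `ker α ≃ W`. -/
structure IsHyperplaneSplitting (α : Dual K V) (i : W →ₗ[K] V) (p : V →ₗ[K] W) (v : V) : Prop where
  form_vector : α v = 1
  form_incl : ∀ w, α (i w) = 0
  proj_incl : ∀ w, p (i w) = w
  incl_proj : ∀ x, i (p x) = x - α x • v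

theorem exists_isHyperplaneSplitting {H : Submodule K V} {α : Dual K V} (hα : α ≠ 0)
    (hH : H = LinearMap.ker α) :
    ∃ (p : V →ₗ[K] H) (v : V), IsHyperplaneSplitting α H.subtype p v := by
  subst hH
  obtain ⟨x, hx⟩ : ∃ x, α x ≠ 0 := by
    by_contra! h
    exact hα (LinearMap.ext h)
  have hv : α ((α x)⁻¹ • x) = 1 := by simp [hx]
  generalize (α x)⁻¹ • x = v at hv
  refine ⟨LinearMap.codRestrict _ (LinearMap.id - α.smulRight v) fun y => ?_, v, hv, fun w => w.2,
    fun w => ?_, fun y => ?_⟩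
  · simp [hv]
  · ext
    change (w : V) - α w • v = w
    rw [show α (w : V) = 0 from w.2, zero_smul, sub_zero]
  · rfl

namespace IsHyperplaneSplitting

variable {α : Dual K V} {i : W →ₗ[K] V} {p : V →ₗ[K] W} {v : V}

theorem pullback_pullback_proj (h : IsHyperplaneSplitting α i p v) (s : Poly K W) :
    Poly.pullback i (Poly.pullback p s) = s := by
  rw [Poly.pullback_pullback, show p ∘ₗ i = LinearMap.id from LinearMap.ext h.proj_incl,
    Poly.pullback_id]

theorem pullback_self (h : IsHyperplaneSplitting α i p v) :
    Poly.pullback i (Poly.form K V α) = 0 := by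
  rw [Poly.pullback_form, show α ∘ₗ i = 0 from LinearMap.ext h.form_incl, map_zero]

/-- The kernel of the restriction of polynomials to the hyperplane `ker α` is generated by `α`. -/
theorem pullback_eq_zero_iff (h : IsHyperplaneSplitting α i p v) (s : Poly K V) :
    Poly.pullback i s = 0 ↔ Poly.form K V α ∣ s := by
  constructor
  · intro hs
    let I : Ideal (Poly K V) := Ideal.span {Poly.form K V α}
    -- Restricting to the hyperplane and extending back along `p` is the identity modulo `α`,
    -- because a form `β` changes by `β v • α`.
    have key : ((Ideal.Quotient.mkₐ K I).comp (Poly.pullback p)).comp (Poly.pullback i)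
        = Ideal.Quotient.mkₐ K I := by
      refine Poly.algHom_ext fun β => ?_
      have hβ : (β ∘ₗ i) ∘ₗ p = β - β v • α := by
        ext x
        simp [h.incl_proj, mul_comm]
      simp only [AlgHom.comp_apply, Poly.pullback_form, hβ]
      rw [← sub_eq_zero, ← map_sub, Ideal.Quotient.mkₐ_eq_mk, Ideal.Quotient.eq_zero_iff_mem,
        Ideal.mem_span_singleton, ← map_sub, sub_sub_cancel_left, map_neg, map_smul, dvd_neg]
      rw [Algebra.smul_def]
      exact dvd_mul_left _ _
    have := DFunLike.congr_fun key s
    simp only [AlgHom.comp_apply, hs, map_zero] at this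
    rw [← Ideal.mem_span_singleton]
    exact Ideal.Quotient.eq_zero_iff_mem.1 this.symm
  · rintro ⟨t, rfl⟩
    rw [map_mul, h.pullback_self, zero_mul]

end IsHyperplaneSplitting

/-- Divisibility by `α` means vanishing on `ker α`, and the polynomials on `ker α` form a domain. -/
theorem prime_form {α : Dual K V} (hα : α ≠ 0) : Prime (Poly.form K V α) := by
  obtain ⟨p, v, h⟩ := exists_isHyperplaneSplitting hα rfl
  refine ⟨mt Poly.form_eq_zero_iff.1 hα, fun hu => ?_, fun a b hab => ?_⟩
  · have := hu.map (Poly.pullback (LinearMap.ker α).subtype)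
    rw [h.pullback_self] at this
    exact not_isUnit_zero this
  · simp only [← h.pullback_eq_zero_iff] at hab ⊢
    rwa [map_mul, mul_eq_zero] at hab

theorem exists_smul_of_ker_le {α β : Dual K V} (h : LinearMap.ker α ≤ LinearMap.ker β) :
    ∃ c : K, β = c • α := by
  have := (mem_span_of_iInf_ker_le_ker (ι := Unit) (L := fun _ => α) (K := β) (by simpa using h))
  rw [Set.range_const, Submodule.mem_span_singleton] at this
  obtain ⟨c, hc⟩ := this
  exact ⟨c, hc.symm⟩

theorem ker_eq_of_form_dvd {α β : Dual K V} (hα : α ≠ 0) (hβ : β ≠ 0)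
    (h : Poly.form K V α ∣ Poly.form K V β) : LinearMap.ker α = LinearMap.ker β := by
  obtain ⟨p, v, hs⟩ := exists_isHyperplaneSplitting hα rfl
  rw [← hs.pullback_eq_zero_iff, Poly.pullback_form, Poly.form_eq_zero_iff] at h
  have h1 : β = β v • α := by
    ext x
    have h2 := hs.incl_proj x
    have h3 := LinearMap.congr_fun h (p x)
    simp only [LinearMap.comp_apply, h2, map_sub, map_smul, smul_eq_mul, LinearMap.zero_apply] at h3
    rw [sub_eq_zero] at h3
    simp [h3, mul_comm]
  have h2 : β v ≠ 0 := fun h0 => hβ (by rw [h1, h0, zero_smul])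
  conv_rhs => rw [h1]
  exact (LinearMap.ker_smul α _ h2).symm

theorem associated_form_of_ker_eq {α β : Dual K V} (hβ : β ≠ 0)
    (h : LinearMap.ker α = LinearMap.ker β) :
    Associated (Poly.form K V α) (Poly.form K V β) := by
  obtain ⟨c, rfl⟩ := exists_smul_of_ker_le h.le
  have hc : c ≠ 0 := by
    rintro rfl
    simp at hβ
  rw [map_smul, Algebra.smul_def, mul_comm]
  exact associated_mul_unit_right _ _ ((IsUnit.mk0 c hc).map _)

end PolynomialRing

/-! ### Derivations with prescribed values on linear forms -/

section Derivations

variable {K : Type u} [Field K] {V W : Type v} [AddCommGroup V] [Module K V]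
  [AddCommGroup W] [Module K W]

open Module

/-- The algebra map `S → S ⊕ εS` corresponding to a linear map on linear forms. -/
noncomputable def dualNumberHom (f : Dual K V →ₗ[K] Poly K V) :
    Poly K V →ₐ[K] TrivSqZeroExt (Poly K V) (Poly K V) :=
  Poly.lift (((TrivSqZeroExt.inlAlgHom K (Poly K V) (Poly K V)).toLinearMap ∘ₗ Poly.form K V) +
    (TrivSqZeroExt.inrHom (Poly K V) (Poly K V)).restrictScalars K ∘ₗ f)

theorem fst_dualNumberHom (f : Dual K V →ₗ[K] Poly K V) (s : Poly K V) :
    (dualNumberHom f s).fst = s := by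
  have : (TrivSqZeroExt.fstHom K (Poly K V) (Poly K V)).comp (dualNumberHom f) =
      AlgHom.id K _ := Poly.algHom_ext fun α => by simp [dualNumberHom]
  exact DFunLike.congr_fun this s

/-- The derivation of `S` with prescribed values on linear forms. -/
noncomputable def mkDer (f : Dual K V →ₗ[K] Poly K V) : Der K V :=
  Derivation.mk' ((TrivSqZeroExt.sndHom (Poly K V) (Poly K V)).restrictScalars K ∘ₗ
    (dualNumberHom f).toLinearMap) fun a b => by
      simp [fst_dualNumberHom, mul_comm]

@[simp]
theorem mkDer_form (f : Dual K V →ₗ[K] Poly K V) (α : Dual K V) :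
    mkDer f (Poly.form K V α) = f α := by
  simp [mkDer, dualNumberHom]

theorem der_ext {θ η : Der K V} (h : ∀ α, θ (Poly.form K V α) = η (Poly.form K V α)) : θ = η := by
  ext s
  induction s using Poly.induction with
  | algebraMap r => simp
  | form α => exact h α
  | mul a b ha hb => simp [ha, hb]
  | add a b ha hb => simp [ha, hb]

end Derivations

end Arrangement

namespace Arrangement

/-! ### Defining polynomial, coefficient matrices and Saito's criterion -/

section Saito

variable {K : Type u} [Field K] {V : Type v} [AddCommGroup V] [Module K V]

open Module

instance Poly.instUniqueFactorizationMonoid : UniqueFactorizationMonoid (Poly K V) :=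
  (SymmetricAlgebra.equivMvPolynomial (Basis.ofVectorSpace K (Dual K V))).symm.toMulEquiv
    |>.uniqueFactorizationMonoid inferInstance

theorem isRelPrime_form {α : Dual K V} (hα : α ≠ 0) {s : Poly K V}
    (h : ¬ Poly.form K V α ∣ s) : IsRelPrime (Poly.form K V α) s :=
  (prime_form hα).irreducible.isRelPrime_iff_not_dvd.2 h

/-- The number of hyperplanes of an arrangement. -/
noncomputable def card (A : Arrangement K V) : ℕ := A.finite.toFinset.card

open Classical in
/-- A linear form with kernel `H` if `H` is a hyperplane. -/
noncomputable def formOf (H : Submodule K V) : Dual K V :=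
  if h : ∃ α : Dual K V, α ≠ 0 ∧ H = LinearMap.ker α then h.choose else 0

theorem formOf_ne_zero (A : Arrangement K V) {H : Submodule K V} (hH : H ∈ A.hyperplanes) :
    formOf H ≠ 0 := by
  rw [formOf, dif_pos (A.isHyperplane H hH)]
  exact (A.isHyperplane H hH).choose_spec.1

theorem ker_formOf (A : Arrangement K V) {H : Submodule K V} (hH : H ∈ A.hyperplanes) :
    LinearMap.ker (formOf H) = H := by
  rw [formOf, dif_pos (A.isHyperplane H hH)]
  exact (A.isHyperplane H hH).choose_spec.2.symm

theorem ne_zero_of_ker_mem (A : Arrangement K V) {α : Dual K V}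
    (h : LinearMap.ker α ∈ A.hyperplanes) : α ≠ 0 := by
  rintro rfl
  obtain ⟨β, hβ, hk⟩ := A.isHyperplane _ h
  rw [LinearMap.ker_zero] at hk
  exact hβ (LinearMap.ker_eq_top.1 hk.symm)

/-- The defining polynomial of an arrangement. -/
noncomputable def defPoly (A : Arrangement K V) : Poly K V :=
  ∏ H ∈ A.finite.toFinset, Poly.form K V (formOf H)

theorem defPoly_mem_homogeneousPart (A : Arrangement K V) :
    A.defPoly ∈ homogeneousPart K V A.card := by
  have := prod_mem_homogeneousPart A.finite.toFinset (fun H => Poly.form K V (formOf H))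
    (fun _ => 1) fun H _ => form_mem_homogeneousPart _
  rwa [Finset.sum_const, smul_eq_mul, mul_one] at this

theorem defPoly_ne_zero (A : Arrangement K V) : A.defPoly ≠ 0 :=
  Finset.prod_ne_zero_iff.2 fun _ hH =>
    mt Poly.form_eq_zero_iff.1 (A.formOf_ne_zero (A.finite.mem_toFinset.1 hH))

theorem form_dvd_defPoly (A : Arrangement K V) {α : Dual K V}
    (h : LinearMap.ker α ∈ A.hyperplanes) : Poly.form K V α ∣ A.defPoly :=
  (associated_form_of_ker_eq (A.formOf_ne_zero h) (A.ker_formOf h).symm).dvd.trans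
    (Finset.dvd_prod_of_mem (fun H => Poly.form K V (formOf H)) (A.finite.mem_toFinset.2 h))

theorem ker_mem_of_form_dvd_defPoly (A : Arrangement K V) {α : Dual K V} (hα : α ≠ 0)
    (h : Poly.form K V α ∣ A.defPoly) : LinearMap.ker α ∈ A.hyperplanes := by
  obtain ⟨H, hH, hd⟩ := (Prime.dvd_finsetProd_iff (prime_form hα) _).1 h
  rw [Set.Finite.mem_toFinset] at hH
  rwa [ker_eq_of_form_dvd hα (A.formOf_ne_zero hH) hd, A.ker_formOf hH]

theorem defPoly_dvd (A : Arrangement K V) {s : Poly K V}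
    (h : ∀ α : Dual K V, LinearMap.ker α ∈ A.hyperplanes → Poly.form K V α ∣ s) :
    A.defPoly ∣ s := by
  refine Finset.prod_dvd_of_isRelPrime (fun H hH H' hH' hne => ?_) fun H hH => ?_
  · have hH := A.finite.mem_toFinset.1 hH
    have hH' := A.finite.mem_toFinset.1 hH'
    refine isRelPrime_form (A.formOf_ne_zero hH) fun hd => hne ?_
    rw [← A.ker_formOf hH, ← A.ker_formOf hH']
    exact ker_eq_of_form_dvd (A.formOf_ne_zero hH) (A.formOf_ne_zero hH') hd
  · have hH := A.finite.mem_toFinset.1 hH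
    exact h _ (by rwa [A.ker_formOf hH])

/-- The defining polynomial is squarefree: forms of distinct hyperplanes are not associated. -/
theorem not_form_dvd_of_defPoly_eq (A : Arrangement K V) {α : Dual K V}
    (hα : LinearMap.ker α ∈ A.hyperplanes) {r : Poly K V}
    (hr : A.defPoly = Poly.form K V α * r) : ¬ Poly.form K V α ∣ r := by
  classical
  intro hd
  have hα0 := A.ne_zero_of_ker_mem hα
  have hmem := A.finite.mem_toFinset.2 hα
  rw [defPoly, ← Finset.mul_prod_erase _ _ hmem] at hr
  have has := associated_form_of_ker_eq (A.formOf_ne_zero hα) (A.ker_formOf hα).symm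
  have h1 := mul_dvd_mul_left (Poly.form K V α) hd
  rw [← hr, (has.mul_right _).symm.dvd_iff_dvd_right,
    mul_dvd_mul_iff_left (prime_form hα0).ne_zero] at h1
  obtain ⟨H', hH', hd'⟩ := (Prime.dvd_finsetProd_iff (prime_form hα0) _).1 h1
  obtain ⟨hne, hH'⟩ := Finset.mem_erase.1 hH'
  rw [Set.Finite.mem_toFinset] at hH'
  refine hne ?_
  rw [ker_eq_of_form_dvd hα0 (A.formOf_ne_zero hH') hd', A.ker_formOf hH']

theorem mem_derivations_iff (A : Arrangement K V) (θ : Der K V) :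
    θ ∈ A.derivations ↔ ∀ α : Dual K V, LinearMap.ker α ∈ A.hyperplanes →
      Poly.form K V α ∣ θ (Poly.form K V α) := by
  simp only [← Ideal.mem_span_singleton]
  rfl

theorem form_dvd_der_of_ker_eq {α β : Dual K V} (h : LinearMap.ker α = LinearMap.ker β)
    {θ : Der K V} (hα : Poly.form K V α ∣ θ (Poly.form K V α)) :
    Poly.form K V β ∣ θ (Poly.form K V β) := by
  obtain ⟨c, rfl⟩ := exists_smul_of_ker_le h.le
  by_cases hc : c = 0
  · simp [hc]
  · rw [map_smul, Derivation.map_smul, Algebra.smul_def, Algebra.smul_def]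
    exact mul_dvd_mul_left _ hα

theorem der_sum_smul_apply {κ : Type*} (s : Finset κ) (c : κ → Poly K V) (θ : κ → Der K V)
    (x : Poly K V) : (∑ i ∈ s, c i • θ i) x = ∑ i ∈ s, c i * θ i x := by
  classical
  induction s using Finset.induction_on with
  | empty => simp
  | insert a s ha ih => simp [Finset.sum_insert ha, ih]

variable {ι : Type*} [Fintype ι]

theorem der_form_eq_sum (b : Basis ι K V) (θ : Der K V) (α : Dual K V) :
    θ (Poly.form K V α) = ∑ j, α (b j) • θ (Poly.form K V (b.coord j)) := by
  conv_lhs => rw [← b.sum_dual_apply_smul_coord α, map_sum, map_sum]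
  simp

/-- A derivation of `S` is given by its values on the coordinates. -/
noncomputable def derEquiv (b : Basis ι K V) : Der K V ≃ₗ[Poly K V] (ι → Poly K V) where
  toFun θ j := θ (Poly.form K V (b.coord j))
  map_add' _ _ := rfl
  map_smul' _ _ := rfl
  invFun f := mkDer
    { toFun := fun α => ∑ j, α (b j) • f j
      map_add' := fun α β => by simp [add_smul, Finset.sum_add_distrib]
      map_smul' := fun c α => by simp [mul_smul, Finset.smul_sum] }
  left_inv θ := der_ext fun α => by
    rw [mkDer_form, der_form_eq_sum b θ α]
    rfl
  right_inv f := by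
    classical
    ext j
    refine (mkDer_form _ _).trans ?_
    simp [Finsupp.single_apply]

@[simp]
theorem derEquiv_apply (b : Basis ι K V) (θ : Der K V) (j : ι) :
    derEquiv b θ j = θ (Poly.form K V (b.coord j)) := rfl

theorem derEquiv_symm_form (b : Basis ι K V) (f : ι → Poly K V) (α : Dual K V) :
    (derEquiv b).symm f (Poly.form K V α) = ∑ j, α (b j) • f j := by
  rw [der_form_eq_sum b]
  simp only [← derEquiv_apply b, LinearEquiv.apply_symm_apply]

/-- The coefficient matrix of a family of derivations. -/
noncomputable def saitoMatrix (b : Basis ι K V) {κ : Type*} (θ : κ → Der K V) :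
    Matrix κ ι (Poly K V) :=
  Matrix.of fun i => derEquiv b (θ i)

@[simp]
theorem saitoMatrix_apply (b : Basis ι K V) {κ : Type*} (θ : κ → Der K V) (i : κ) (j : ι) :
    saitoMatrix b θ i j = θ i (Poly.form K V (b.coord j)) := rfl

theorem smul_der_left_cancel {s : Poly K V} (hs : s ≠ 0) {θ η : Der K V} (h : s • θ = s • η) :
    θ = η :=
  der_ext fun α => mul_left_cancel₀ hs (DFunLike.congr_fun h (Poly.form K V α))

variable [DecidableEq ι]

theorem linearIndependent_rows_iff_det_ne_zero {R : Type*} [CommRing R] [IsDomain R]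
    (M : Matrix ι ι R) : LinearIndependent R (fun i => M i) ↔ M.det ≠ 0 := by
  refine ⟨fun h h0 => ?_, Matrix.linearIndependent_rows_of_det_ne_zero⟩
  obtain ⟨v, hv, hM⟩ := Matrix.exists_vecMul_eq_zero_iff.2 h0
  refine hv (funext fun i => Fintype.linearIndependent_iff.1 h v ?_ i)
  rw [← hM]
  ext j
  simp [Matrix.vecMul, dotProduct]

theorem det_saitoMatrix_ne_zero_iff (b : Basis ι K V) (θ : ι → Der K V) :
    (saitoMatrix b θ).det ≠ 0 ↔ LinearIndependent (Poly K V) θ := by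
  rw [← linearIndependent_rows_iff_det_ne_zero,
    ← LinearMap.linearIndependent_iff (derEquiv b).toLinearMap (derEquiv b).ker]
  rfl

theorem det_mem_homogeneousPart (M : Matrix ι ι (Poly K V)) (d : ι → ℕ)
    (h : ∀ i j, M i j ∈ homogeneousPart K V (d i)) :
    M.det ∈ homogeneousPart K V (∑ i, d i) := by
  rw [Matrix.det_apply]
  refine Submodule.sum_mem _ fun σ _ => ?_
  have : ∏ i, M (σ i) i ∈ homogeneousPart K V (∑ i, d i) := by
    rw [← Equiv.sum_comp σ]
    exact prod_mem_homogeneousPart _ _ (fun i => d (σ i)) fun i _ => h _ _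
  rcases Int.units_eq_one_or (Equiv.Perm.sign σ) with hs | hs
  · simpa [hs] using this
  · simpa [hs] using this

/-- Replacing column `j` by the combination of columns with coefficients `α (b i)` multiplies the
determinant by the unit `α (b j)`. The new column consists of the values `θ k α`, all divisible by
`α`. -/
theorem form_dvd_det {θ : ι → Der K V} (b : Basis ι K V) {α : Dual K V} (hα : α ≠ 0)
    (h : ∀ i, Poly.form K V α ∣ θ i (Poly.form K V α)) :
    Poly.form K V α ∣ (saitoMatrix b θ).det := by
  obtain ⟨j, hj⟩ : ∃ j, α (b j) ≠ 0 := by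
    by_contra! h0
    exact hα (b.ext h0)
  have := Matrix.det_updateCol_sum (saitoMatrix b θ) j
    fun j => algebraMap K (Poly K V) (α (b j))
  have hcol : (fun k => ∑ i, (algebraMap K (Poly K V) (α (b i))) • saitoMatrix b θ k i) =
      fun k => θ k (Poly.form K V α) := by
    ext k
    rw [der_form_eq_sum b]
    simp [Algebra.smul_def]
  rw [hcol, smul_eq_mul] at this
  rw [← ((IsUnit.mk0 _ hj).map (algebraMap K (Poly K V))).dvd_mul_left, ← this,
    Matrix.det_apply]
  refine Finset.dvd_sum fun σ _ => ?_
  have hd : Poly.form K V α ∣ ∏ i, (saitoMatrix b θ).updateCol j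
      (fun k => θ k (Poly.form K V α)) (σ i) i := by
    refine Dvd.dvd.trans ?_ (Finset.dvd_prod_of_mem _ (Finset.mem_univ j))
    simpa using h (σ j)
  rcases Int.units_eq_one_or (Equiv.Perm.sign σ) with hs | hs
  · simpa [hs] using hd
  · simpa [hs] using hd

theorem defPoly_dvd_det (A : Arrangement K V) (b : Basis ι K V) {θ : ι → Der K V}
    (hθ : ∀ i, θ i ∈ A.derivations) : A.defPoly ∣ (saitoMatrix b θ).det :=
  A.defPoly_dvd fun α hα => form_dvd_det b (A.ne_zero_of_ker_mem hα) fun i =>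
    (A.mem_derivations_iff _).1 (hθ i) α hα

theorem exists_det_eq_defPoly_mul (A : Arrangement K V) (b : Basis ι K V) {θ : ι → Der K V}
    {d : ι → ℕ} (hθ : ∀ i, θ i ∈ A.derivations) (hd : ∀ i, IsHomogeneousDer (θ i) (d i))
    (hli : LinearIndependent (Poly K V) θ) :
    A.card ≤ ∑ i, d i ∧ ∃ w ∈ homogeneousPart K V (∑ i, d i - A.card), w ≠ 0 ∧
      (saitoMatrix b θ).det = w * A.defPoly := by
  obtain ⟨w, hw⟩ := A.defPoly_dvd_det b hθ
  have h0 := (det_saitoMatrix_ne_zero_iff b θ).2 hli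
  have hw0 : w ≠ 0 := by
    rintro rfl
    exact h0 (by rw [hw, mul_zero])
  rw [mul_comm] at hw
  have hm := det_mem_homogeneousPart (saitoMatrix b θ) d fun i j => hd i _
  rw [hw] at hm
  obtain ⟨h1, h2⟩ := mem_homogeneousPart_of_mul hw0 A.defPoly_ne_zero hm
    A.defPoly_mem_homogeneousPart
  exact ⟨h1, w, h2, hw0, hw⟩

/-- The degrees of independent homogeneous `A`-derivations add up to at least `|A|`. -/
theorem card_le_sum_degrees (A : Arrangement K V) (b : Basis ι K V) {θ : ι → Der K V}
    {d : ι → ℕ} (hθ : ∀ i, θ i ∈ A.derivations) (hd : ∀ i, IsHomogeneousDer (θ i) (d i))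
    (hli : LinearIndependent (Poly K V) θ) : A.card ≤ ∑ i, d i :=
  (A.exists_det_eq_defPoly_mul b hθ hd hli).1

/-- **Saito's criterion**: independent homogeneous `A`-derivations whose degrees add up to `|A|`
form a basis of `D(A)`. -/
theorem exists_basis_of_sum_degrees_le (A : Arrangement K V) (b : Basis ι K V) {θ : ι → Der K V}
    {d : ι → ℕ} (hθ : ∀ i, θ i ∈ A.derivations) (hd : ∀ i, IsHomogeneousDer (θ i) (d i))
    (hli : LinearIndependent (Poly K V) θ) (hsum : ∑ i, d i ≤ A.card) :
    ∃ B : Basis ι (Poly K V) A.derivations, ∀ i, (B i : Der K V) = θ i := by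
  obtain ⟨-, w, hw, hw0, hdet⟩ := A.exists_det_eq_defPoly_mul b hθ hd hli
  rw [Nat.sub_eq_zero_of_le hsum] at hw
  -- The cofactor of the defining polynomial has degree `0`, so the determinant equals that
  -- polynomial up to a unit.
  have hunit := isUnit_of_mem_homogeneousPart_zero hw hw0
  have h0 := (det_saitoMatrix_ne_zero_iff b θ).2 hli
  have hspan : ∀ η ∈ A.derivations, ∃ c : ι → Poly K V, η = ∑ i, c i • θ i := by
    intro η hη
    -- Cramer's rule writes `det • η` in the `θ i`. Each coefficient is the determinant of a family
    -- in `D(A)`, with `η` in place of `θ i`, so `det` divides it and can be cancelled.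
    have hdvd : ∀ i, (saitoMatrix b θ).det ∣
        Matrix.cramer (saitoMatrix b θ).transpose (derEquiv b η) i := by
      intro i
      rw [Matrix.cramer_transpose_apply, hdet, hunit.mul_left_dvd]
      have : (saitoMatrix b θ).updateRow i (derEquiv b η) =
          saitoMatrix b (Function.update θ i η) := by
        ext k l
        by_cases hk : k = i
        · subst hk; simp
        · simp [hk]
      rw [this]
      refine A.defPoly_dvd_det b fun k => ?_
      by_cases hk : k = i
      · subst hk; simpa using hη
      · simpa [hk] using hθ k
    choose c hc using hdvd
    refine ⟨c, smul_der_left_cancel h0 ((derEquiv b).injective ?_)⟩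
    have := Matrix.mulVec_cramer (saitoMatrix b θ).transpose (derEquiv b η)
    rw [Matrix.det_transpose] at this
    rw [map_smul, ← this]
    ext j
    simp only [Matrix.mulVec, dotProduct, hc, Matrix.transpose_apply, saitoMatrix_apply,
      derEquiv_apply, Derivation.smul_apply, der_sum_smul_apply, smul_eq_mul, Finset.mul_sum]
    exact Finset.sum_congr rfl fun i _ => by ring
  let θ' : ι → A.derivations := fun i => ⟨θ i, hθ i⟩
  have hli' : LinearIndependent (Poly K V) θ' :=
    LinearIndependent.of_comp A.derivations.subtype hli
  refine ⟨Basis.mk hli' ?_, fun i => by rw [Basis.mk_apply]⟩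
  rintro ⟨η, hη⟩ -
  obtain ⟨c, hc⟩ := hspan η hη
  have : (⟨η, hη⟩ : A.derivations) = ∑ i, c i • θ' i := by
    ext1
    simp only [Submodule.coe_sum, Submodule.coe_smul]
    exact hc
  rw [this]
  exact Submodule.sum_mem _ fun i _ => Submodule.smul_mem _ _ (Submodule.subset_span ⟨i, rfl⟩)

theorem form_dvd_of_dvd_mul {α β : Dual K V} (hα : α ≠ 0) (hβ : β ≠ 0)
    (hne : LinearMap.ker α ≠ LinearMap.ker β) {s : Poly K V}
    (h : Poly.form K V α ∣ Poly.form K V β * s) : Poly.form K V α ∣ s :=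
  ((prime_form hα).dvd_or_dvd h).resolve_left fun hd => hne (ker_eq_of_form_dvd hα hβ hd)

/-- `D(A)` lies between `Q · Der(S)` and `Der(S)`, with `Q` the defining polynomial, so its rank is
`dim V`. -/
theorem card_eq_of_basis_derivations (A : Arrangement K V) (b : Basis ι K V) {κ : Type*}
    [Fintype κ] (θ : Basis κ (Poly K V) A.derivations) : Fintype.card κ = Fintype.card ι := by
  have : Module.Finite (Poly K V) (Der K V) := Module.Finite.equiv (derEquiv b).symm
  have : Module.Finite (Poly K V) A.derivations := Module.Finite.of_basis θ
  apply le_antisymm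
  · have h := (θ.linearIndependent.map' A.derivations.subtype
      (Submodule.ker_subtype _)).fintype_card_le_finrank
    rwa [(derEquiv b).finrank_eq, Module.finrank_fintype_fun_eq_card] at h
  · let η : ι → A.derivations := fun i => ⟨A.defPoly • (derEquiv b).symm (Pi.single i 1), by
      rw [mem_derivations_iff]
      intro α hα
      exact (A.form_dvd_defPoly hα).mul_right _⟩
    have hη : LinearIndependent (Poly K V) η := by
      refine LinearIndependent.of_comp A.derivations.subtype ?_
      change LinearIndependent (Poly K V)
        fun i => A.defPoly • (derEquiv b).symm (Pi.single i (1 : Poly K V))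
      rw [← det_saitoMatrix_ne_zero_iff b]
      have : saitoMatrix b (fun i => A.defPoly • (derEquiv b).symm (Pi.single i (1 : Poly K V))) =
          Matrix.diagonal fun _ => A.defPoly := by
        ext i j : 2
        simp [saitoMatrix, Matrix.diagonal, Pi.single_apply, eq_comm]
      rw [this, Matrix.det_diagonal]
      exact Finset.prod_ne_zero_iff.2 fun _ _ => A.defPoly_ne_zero
    have h := hη.fintype_card_le_finrank
    rwa [Module.finrank_eq_card_basis θ] at h

theorem det_dvd_det_of_basis (A : Arrangement K V) (b : Basis ι K V)
    (θ : Basis ι (Poly K V) A.derivations) {η : ι → Der K V} (hη : ∀ i, η i ∈ A.derivations) :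
    (saitoMatrix b fun i => (θ i : Der K V)).det ∣ (saitoMatrix b η).det := by
  have h : saitoMatrix b η = (Matrix.of fun i j => θ.repr ⟨η i, hη i⟩ j) *
      saitoMatrix b fun i => (θ i : Der K V) := by
    ext i j
    have h1 := congrArg (Subtype.val) (θ.sum_repr ⟨η i, hη i⟩)
    simp only [Submodule.coe_sum, Submodule.coe_smul] at h1
    rw [Matrix.mul_apply, saitoMatrix_apply, ← h1, der_sum_smul_apply]
    rfl
  rw [h, Matrix.det_mul]
  exact dvd_mul_left _ _

/-- A multiple of a coordinate frame adapted to the hyperplane `ker α`. -/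
theorem exists_frame_of_form_dvd (A : Arrangement K V) (b : Basis ι K V) {α : Dual K V}
    (hα : LinearMap.ker α ∈ A.hyperplanes) {r : Poly K V}
    (hr : A.defPoly = Poly.form K V α * r) :
    ∃ η : ι → Der K V, (∀ i, η i ∈ A.derivations) ∧
      (saitoMatrix b η).det = Poly.form K V α * r ^ Fintype.card ι := by
  have hα0 := A.ne_zero_of_ker_mem hα
  obtain ⟨k, hk⟩ : ∃ j, α (b j) ≠ 0 := by
    by_contra! h0
    exact hα0 (b.ext h0)
  -- With `∂ i` dual to the coordinates, the frame is `r • (∂ i - (α (b i) / α (b k)) • ∂ k)` for `i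
  -- ≠ k`, which kills `α`, together with `α r • ∂ k`. The matrix `N` is the unipotent change of
  -- frame.
  let N : Matrix ι ι (Poly K V) := Matrix.of fun i j =>
    (1 : Matrix ι ι (Poly K V)) i j + (if i = k then 0 else algebraMap K (Poly K V)
      (-(α (b i) / α (b k)))) * (1 : Matrix ι ι (Poly K V)) k j
  have hN : N.det = 1 := by
    have := Matrix.det_eq_of_forall_row_eq_smul_add_const (A := N)
      (B := (1 : Matrix ι ι (Poly K V))) (fun i => if i = k then 0 else algebraMap K (Poly K V)
      (-(α (b i) / α (b k)))) k (by simp) fun i j => rfl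
    rw [this, Matrix.det_one]
  let w : ι → Poly K V := fun i => (if i = k then Poly.form K V α else 1) * r
  refine ⟨fun i => (derEquiv b).symm fun j => w i * N i j, fun i => ?_, ?_⟩
  · have hself : Poly.form K V α ∣ (derEquiv b).symm (fun j => w i * N i j)
        (Poly.form K V α) := by
      rw [derEquiv_symm_form]
      simp only [← mul_smul_comm, ← Finset.mul_sum]
      by_cases hi : i = k
      · simp only [w, if_pos hi]
        exact ((dvd_mul_right _ _).mul_right _)
      · refine Dvd.dvd.mul_left ?_ _
        have : ∑ j, α (b j) • N i j = 0 := by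
          simp only [N, Matrix.of_apply, if_neg hi, smul_add, Finset.sum_add_distrib,
            Matrix.one_apply, mul_ite, mul_one, mul_zero, smul_ite, smul_zero, Finset.sum_ite_eq,
            Finset.mem_univ, if_true]
          rw [Algebra.smul_def, Algebra.smul_def, mul_one, ← map_mul, ← map_add,
            mul_neg, mul_div_cancel₀ _ hk, add_neg_cancel, map_zero]
        rw [this]
        exact dvd_zero _
    rw [mem_derivations_iff]
    intro β hβ
    by_cases hne : LinearMap.ker β = LinearMap.ker α
    · exact form_dvd_der_of_ker_eq hne.symm hself
    · have hd : Poly.form K V β ∣ r :=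
        form_dvd_of_dvd_mul (A.ne_zero_of_ker_mem hβ) hα0 hne (hr ▸ A.form_dvd_defPoly hβ)
      rw [derEquiv_symm_form]
      refine Finset.dvd_sum fun j _ => ?_
      rw [Algebra.smul_def]
      exact ((hd.mul_left _).mul_right _).mul_left _
  · have : saitoMatrix b (fun i => (derEquiv b).symm fun j => w i * N i j) =
        Matrix.of fun i j => w i * N i j := by
      ext1 i
      simp [saitoMatrix]
    rw [this, Matrix.det_mul_column, hN, mul_one, Finset.prod_mul_distrib, Finset.prod_ite_eq']
    simp

/-- Write `det = Q u` with `Q` the defining polynomial. The frame `Q • ∂ i` gives `u ∣ Q ^ ℓ`, where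
`ℓ = dim V`. For `Q = α r` the adapted frame gives `r u ∣ r ^ ℓ`, so `α ∣ u` would force `α ∣ r`,
against squarefreeness. Hence `u` is prime to `Q ^ ℓ` and a unit. Homogeneity of the basis plays no
role. -/
theorem associated_det_defPoly (A : Arrangement K V) (b : Basis ι K V)
    (θ : Basis ι (Poly K V) A.derivations) :
    Associated (saitoMatrix b fun i => (θ i : Der K V)).det A.defPoly := by
  obtain ⟨u, hu⟩ := A.defPoly_dvd_det b fun i => (θ i).2
  have hpow : A.defPoly * u ∣ A.defPoly ^ Fintype.card ι := by
    rw [← hu]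
    have := A.det_dvd_det_of_basis b θ
      (η := fun i => (derEquiv b).symm fun j => A.defPoly * (1 : Matrix ι ι (Poly K V)) i j)
      fun i => by
        rw [mem_derivations_iff]
        intro α hα
        rw [derEquiv_symm_form]
        refine Finset.dvd_sum fun j _ => ?_
        rw [Algebra.smul_def]
        exact ((A.form_dvd_defPoly hα).mul_right _).mul_left _
    have hM : saitoMatrix b (fun i => (derEquiv b).symm
        fun j => A.defPoly * (1 : Matrix ι ι (Poly K V)) i j) =
        Matrix.of fun i j => A.defPoly * (1 : Matrix ι ι (Poly K V)) i j := by
      ext1 i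
      simp [saitoMatrix]
    rw [hM, Matrix.det_mul_column (fun _ => A.defPoly), Matrix.det_one, mul_one] at this
    simpa using this
  have hndvd : ∀ H ∈ A.finite.toFinset, ¬ Poly.form K V (formOf H) ∣ u := by
    intro H hH hdu
    rw [Set.Finite.mem_toFinset] at hH
    have hα0 := A.formOf_ne_zero hH
    have hker : LinearMap.ker (formOf H) ∈ A.hyperplanes := by rwa [A.ker_formOf hH]
    generalize formOf H = α at hα0 hker hdu
    obtain ⟨r, hr⟩ := A.form_dvd_defPoly hker
    have hfα := (prime_form hα0).ne_zero
    obtain ⟨η, hη, hdet⟩ := A.exists_frame_of_form_dvd b hker hr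
    have h1 := A.det_dvd_det_of_basis b θ hη
    rw [hdet, hu, hr, mul_assoc, mul_dvd_mul_iff_left hfα] at h1
    exact A.not_form_dvd_of_defPoly_eq hker hr
      ((prime_form hα0).dvd_of_dvd_pow ((hdu.mul_left _).trans h1))
  have hrel : IsRelPrime (A.defPoly ^ Fintype.card ι) u :=
    (IsRelPrime.prod_left fun H hH => isRelPrime_form
      (A.formOf_ne_zero (A.finite.mem_toFinset.1 hH)) (hndvd H hH)).pow_left
  have hunit : IsUnit u := hrel ((dvd_mul_left _ _).trans hpow) dvd_rfl
  rw [hu]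
  exact (associated_mul_unit_left _ _ hunit)

theorem linearIndependent_coe_basis {A : Arrangement K V} {κ : Type*}
    (θ : Basis κ (Poly K V) A.derivations) :
    LinearIndependent (Poly K V) fun i => (θ i : Der K V) :=
  θ.linearIndependent.map' A.derivations.subtype (Submodule.ker_subtype _)

/-- The determinant is homogeneous of degree `∑ d i` and associated to the defining polynomial, of
degree `|A|`; a homogeneous unit has degree `0`, so the two degrees agree. -/
theorem IsFreeWithExponents.exists_basis {A : Arrangement K V} {e : Multiset ℕ}
    (h : A.IsFreeWithExponents e) (b : Basis ι K V) :
    ∃ (θ : Basis ι (Poly K V) A.derivations) (d : ι → ℕ),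
      (∀ i, IsHomogeneousDer (θ i : Der K V) (d i)) ∧ e = Finset.univ.val.map d ∧
      ∑ i, d i = A.card := by
  obtain ⟨κ, _, θ, d, hd, rfl⟩ := h
  let σ := Fintype.equivOfCardEq (A.card_eq_of_basis_derivations b θ)
  have hd' : ∀ i, IsHomogeneousDer (θ.reindex σ i : Der K V) ((d ∘ σ.symm) i) := fun i => by
    simpa using hd (σ.symm i)
  refine ⟨θ.reindex σ, d ∘ σ.symm, hd', ?_, ?_⟩
  · rw [← Multiset.map_map, show (Finset.univ : Finset ι).val.map σ.symm =
      (Finset.univ : Finset κ).val from ?_]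
    exact congrArg Finset.val (Finset.map_univ_equiv σ.symm)
  · have h1 := det_mem_homogeneousPart (saitoMatrix b fun i => (θ.reindex σ i : Der K V))
      (d ∘ σ.symm) fun i j => hd' i _
    obtain ⟨u, hu⟩ := A.associated_det_defPoly b (θ.reindex σ)
    obtain ⟨hle, w, hw, hw0, hdet⟩ := A.exists_det_eq_defPoly_mul b
      (fun i => (θ.reindex σ i).2) hd' (linearIndependent_coe_basis (θ.reindex σ))
    have h2 : A.card = A.card + (∑ i, (d ∘ σ.symm) i - A.card) +
        0 := by
      rw [hdet] at hu
      have h3 : w * (u : Poly K V) = 1 := by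
        apply mul_right_cancel₀ A.defPoly_ne_zero
        rw [one_mul, mul_right_comm, hu]
      have h4 := mem_homogeneousPart_of_mul u.ne_zero hw0
        (by rw [mul_comm, h3]; exact one_mem_homogeneousPart) hw
      omega
    omega

theorem isFreeWithExponents_of_sum_degrees_le {ι : Type} [Fintype ι] (A : Arrangement K V)
    (b : Basis ι K V) {θ : ι → Der K V} {d : ι → ℕ} (hθ : ∀ i, θ i ∈ A.derivations)
    (hd : ∀ i, IsHomogeneousDer (θ i) (d i)) (hli : LinearIndependent (Poly K V) θ)
    (hsum : ∑ i, d i ≤ A.card) : A.IsFreeWithExponents (Finset.univ.val.map d) := by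
  classical
  obtain ⟨B, hB⟩ := A.exists_basis_of_sum_degrees_le b hθ hd hli hsum
  exact ⟨ι, inferInstance, B, d, fun i => by rw [hB]; exact hd i, rfl⟩

/-- Used for `A'` and the form of the deleted hyperplane `H`: a basis of `D(A')` stays nonsingular
on `H`. -/
theorem not_form_dvd_det (A : Arrangement K V) (b : Basis ι K V)
    (θ : Basis ι (Poly K V) A.derivations) {α : Dual K V} (hα : α ≠ 0)
    (h : LinearMap.ker α ∉ A.hyperplanes) :
    ¬ Poly.form K V α ∣ (saitoMatrix b fun i => (θ i : Der K V)).det := by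
  rw [(A.associated_det_defPoly b θ).dvd_iff_dvd_right]
  exact mt (A.ker_mem_of_form_dvd_defPoly hα) h

variable (A : Arrangement K V) in
/-- `A` is free. -/
def IsFree : Prop := ∃ e, A.IsFreeWithExponents e

end Saito

end Arrangement

namespace Arrangement

/-! ### Restricting derivations to a hyperplane; Terao's polynomial -/

section Restriction

variable {K : Type u} [Field K] {V W : Type v} [AddCommGroup V] [Module K V]
  [AddCommGroup W] [Module K W]

open Module

/-- The derivation of the polynomials on `W` induced by a derivation of the polynomials on `V`,
an inclusion `i : W → V` and a projection `p : V → W`. -/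
noncomputable def restrictDer (i : W →ₗ[K] V) (p : V →ₗ[K] W) (θ : Der K V) : Der K W :=
  mkDer
    { toFun := fun γ => Poly.pullback i (θ (Poly.form K V (γ ∘ₗ p)))
      map_add' := fun γ δ => by simp [LinearMap.add_comp]
      map_smul' := fun c γ => by simp [LinearMap.smul_comp] }

theorem restrictDer_form (i : W →ₗ[K] V) (p : V →ₗ[K] W) (θ : Der K V) (γ : Dual K W) :
    restrictDer i p θ (Poly.form K W γ) = Poly.pullback i (θ (Poly.form K V (γ ∘ₗ p))) :=
  mkDer_form _ _

theorem IsHomogeneousDer.restrictDer {θ : Der K V} {d : ℕ} (h : IsHomogeneousDer θ d)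
    (i : W →ₗ[K] V) (p : V →ₗ[K] W) : IsHomogeneousDer (restrictDer i p θ) d := fun γ => by
  rw [restrictDer_form]
  exact pullback_mem_homogeneousPart i (h _)

namespace IsHyperplaneSplitting

variable {α : Dual K V} {i : W →ₗ[K] V} {p : V →ₗ[K] W} {v : V}

/-- Extending `β ∘ₗ i` back along `p` changes `β` by a multiple of `α`, and `θ α` vanishes on the
hyperplane. So the choice of `p` is immaterial for derivations that preserve `(α)`. -/
theorem restrictDer_form_comp (h : IsHyperplaneSplitting α i p v) {θ : Der K V}
    (hθ : Poly.form K V α ∣ θ (Poly.form K V α)) (β : Dual K V) :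
    Arrangement.restrictDer i p θ (Poly.form K W (β ∘ₗ i)) =
      Poly.pullback i (θ (Poly.form K V β)) := by
  have hβ : (β ∘ₗ i) ∘ₗ p = β - β v • α := by
    ext x
    simp [h.incl_proj, mul_comm]
  rw [restrictDer_form, hβ, map_sub, map_smul, map_sub, Derivation.map_smul, map_sub, map_smul,
    (h.pullback_eq_zero_iff _).2 hθ, smul_zero, sub_zero]

variable {ι κ : Type*} [Fintype ι] [DecidableEq ι]

/-- Derivations independent modulo `α` that preserve `(α)` restrict to independent derivations. -/
theorem linearIndependent_restrictDer (h : IsHyperplaneSplitting α i p v) (b : Basis ι K V)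
    {θ : ι → Der K V} (hdet : ¬ Poly.form K V α ∣ (saitoMatrix b θ).det) (f : κ → ι)
    (hf : Function.Injective f) (hθ : ∀ k, Poly.form K V α ∣ θ (f k) (Poly.form K V α)) :
    LinearIndependent (Poly K W) fun k => Arrangement.restrictDer i p (θ (f k)) := by
  -- `M` is the coefficient matrix on the hyperplane, nonsingular since `α` does not divide the
  -- determinant. Its rows indexed by `f` hold the values of the restricted derivations on all
  -- restricted coordinates.
  let M : Matrix ι ι (Poly K W) := (saitoMatrix b θ).map (Poly.pullback i)
  have hM : M.det ≠ 0 := by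
    have := (Poly.pullback i).map_det (saitoMatrix b θ)
    rw [← h.pullback_eq_zero_iff, this] at hdet
    exact hdet
  have hli := ((linearIndependent_rows_iff_det_ne_zero M).2 hM).comp f hf
  let ev : Der K W →ₗ[Poly K W] (ι → Poly K W) :=
    { toFun := fun η j => η (Poly.form K W (b.coord j ∘ₗ i))
      map_add' := fun _ _ => rfl
      map_smul' := fun _ _ => rfl }
  refine LinearIndependent.of_comp ev ?_
  convert hli using 1
  ext k j
  exact h.restrictDer_form_comp (hθ k) (b.coord j)

end IsHyperplaneSplitting

theorem card_deletion_add_one (A : Arrangement K V) {H : Submodule K V}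
    (hH : H ∈ A.hyperplanes) : (A.deletion H).card + 1 = A.card := by
  rw [card, card, ← Set.ncard_eq_toFinset_card _ A.finite,
    ← Set.ncard_eq_toFinset_card _ (A.deletion H).finite]
  exact Set.ncard_sdiff_singleton_add_one hH A.finite

theorem eq_of_le_hyperplane (A : Arrangement K V) {H H' : Submodule K V} (hH : H ∈ A.hyperplanes)
    (hH' : H' ∈ A.hyperplanes) (h : H ≤ H') : H = H' := by
  rw [← A.ker_formOf hH, ← A.ker_formOf hH'] at h ⊢
  obtain ⟨c, hc⟩ := exists_smul_of_ker_le h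
  have hc0 : c ≠ 0 := by
    rintro rfl
    exact A.formOf_ne_zero hH' (by rw [hc, zero_smul])
  rw [hc, LinearMap.ker_smul _ _ hc0]

theorem comap_mem_restriction (A : Arrangement K V) {H H' : Submodule K V}
    (hH : H ∈ A.hyperplanes) (hH' : H' ∈ (A.deletion H).hyperplanes) :
    H'.comap H.subtype ∈ (A.restriction H).hyperplanes :=
  ⟨H', ⟨hH'.1, fun hle => hH'.2 (A.eq_of_le_hyperplane hH hH'.1 hle).symm⟩, rfl⟩

theorem exists_of_mem_restriction (A : Arrangement K V) {H : Submodule K V}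
    {Y : Submodule K H} (hY : Y ∈ (A.restriction H).hyperplanes) :
    ∃ H' ∈ (A.deletion H).hyperplanes, H'.comap H.subtype = Y := by
  obtain ⟨H', ⟨h1, h2⟩, rfl⟩ := hY
  exact ⟨H', ⟨h1, fun h => h2 (le_of_eq (Set.mem_singleton_iff.1 h).symm)⟩, rfl⟩

theorem restrictDer_mem_derivations (A : Arrangement K V) {H : Submodule K V} {α : Dual K V}
    {p : V →ₗ[K] H} {v : V} (hα : H = LinearMap.ker α)
    (h : IsHyperplaneSplitting α H.subtype p v) (hH : H ∈ A.hyperplanes) {θ : Der K V}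
    (hθ : θ ∈ A.derivations) :
    restrictDer H.subtype p θ ∈ (A.restriction H).derivations := by
  rw [mem_derivations_iff] at hθ ⊢
  intro γ hγ
  obtain ⟨H', hH', hker⟩ := A.exists_of_mem_restriction hγ
  have hker' := A.ker_formOf hH'.1
  have hd := hθ (formOf H') (by rw [hker']; exact hH'.1)
  have hk : LinearMap.ker (formOf H' ∘ₗ H.subtype) = LinearMap.ker γ := by
    rw [← hker, LinearMap.ker_comp, hker']
  refine form_dvd_der_of_ker_eq hk ?_
  rw [h.restrictDer_form_comp (hθ α (hα ▸ hH)), ← Poly.pullback_form]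
  exact map_dvd _ hd

/-- Terao's polynomial: `θ(α_H)` for `θ ∈ D(A')` is divisible on `H` by a polynomial of degree
`|A'| - |A''|`. -/
theorem exists_dvd_restrict_form (A : Arrangement K V) {H : Submodule K V} {α : Dual K V}
    (hα : H = LinearMap.ker α) (hH : H ∈ A.hyperplanes) :
    ∃ (m : ℕ) (B : Poly K H), (A.deletion H).card = (A.restriction H).card + m ∧ B ≠ 0 ∧
      B ∈ homogeneousPart K H m ∧ ∀ θ ∈ (A.deletion H).derivations,
        B ∣ Poly.pullback H.subtype (θ (Poly.form K V α)) := by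
  classical
  set A' := A.deletion H with hA'
  set A'' := A.restriction H with hA''
  obtain ⟨p, v, hs⟩ := exists_isHyperplaneSplitting
    (A.ne_zero_of_ker_mem (hα ▸ hH)) hα
  -- `F Y` collects the hyperplanes of `A'` that meet `H` in `Y`; the polynomial is the product of
  -- the `α_Y ^ (|F Y| - 1)`.
  let F : Submodule K H → Finset (Submodule K V) := fun Y =>
    A'.finite.toFinset.filter fun H' => H'.comap H.subtype = Y
  have hF : ∀ {Y H'}, H' ∈ F Y ↔ H' ∈ A'.hyperplanes ∧ H'.comap H.subtype = Y := by
    simp [F]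
  have hFpos : ∀ Y ∈ A''.finite.toFinset, 1 ≤ (F Y).card := by
    intro Y hY
    obtain ⟨H', h1, h2⟩ := A.exists_of_mem_restriction (A''.finite.mem_toFinset.1 hY)
    exact Finset.card_pos.2 ⟨H', hF.2 ⟨h1, h2⟩⟩
  have hcard : A'.card = ∑ Y ∈ A''.finite.toFinset, (F Y).card :=
    Finset.card_eq_sum_card_fiberwise fun H' hH' => A''.finite.mem_toFinset.2
      (A.comap_mem_restriction hH (A'.finite.mem_toFinset.1 hH'))
  refine ⟨∑ Y ∈ A''.finite.toFinset, ((F Y).card - 1),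
    ∏ Y ∈ A''.finite.toFinset, Poly.form K H (formOf Y) ^ ((F Y).card - 1), ?_, ?_, ?_, ?_⟩
  · rw [hcard, card, Finset.card_eq_sum_ones, ← Finset.sum_add_distrib]
    exact Finset.sum_congr rfl fun Y hY => (Nat.add_sub_of_le (hFpos Y hY)).symm
  · exact Finset.prod_ne_zero_iff.2 fun Y hY => pow_ne_zero _
      (mt Poly.form_eq_zero_iff.1 (A''.formOf_ne_zero (A''.finite.mem_toFinset.1 hY)))
  · refine prod_mem_homogeneousPart _ _ _ fun Y _ => ?_
    simpa using pow_mem_homogeneousPart (form_mem_homogeneousPart (formOf Y)) ((F Y).card - 1)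
  intro θ hθ
  refine Finset.prod_dvd_of_isRelPrime (fun Y hY Y' hY' hne => IsRelPrime.pow ?_) fun Y hY => ?_
  · have hY := A''.finite.mem_toFinset.1 hY
    have hY' := A''.finite.mem_toFinset.1 hY'
    refine isRelPrime_form (A''.formOf_ne_zero hY) fun hd => hne ?_
    rw [← A''.ker_formOf hY, ← A''.ker_formOf hY']
    exact ker_eq_of_form_dvd (A''.formOf_ne_zero hY) (A''.formOf_ne_zero hY') hd
  have hpos := hFpos Y hY
  rw [Set.Finite.mem_toFinset] at hY
  obtain ⟨H₁, hH₁⟩ := Finset.card_pos.1 hpos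
  have hγ0 := A''.formOf_ne_zero hY
  have hres : ∀ H' ∈ F Y, LinearMap.ker (formOf H' ∘ₗ H.subtype) = LinearMap.ker (formOf Y) := by
    intro H' hH'
    obtain ⟨h1, h2⟩ := hF.1 hH'
    rw [LinearMap.ker_comp, A'.ker_formOf h1, h2, A''.ker_formOf hY]
  have hne : ∀ H' ∈ F Y, formOf H' ∘ₗ H.subtype ≠ 0 := fun H' hH' => by
    refine A''.ne_zero_of_ker_mem ?_
    rwa [hres H' hH', A''.ker_formOf hY]
  -- On the pencil through `Y` each form is `c • α_{H₁} + e • α`. Replacing `H₁` by `H'` only scales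
  -- the expression by the unit `c`, and for `H'` itself divisibility is clear.
  have hdvd : ∀ H' ∈ F Y, Poly.form K V (formOf H') ∣
      Poly.form K V α * θ (Poly.form K V (formOf H₁)) -
        Poly.form K V (formOf H₁) * θ (Poly.form K V α) := by
    intro H' hH'
    obtain ⟨h1, -⟩ := hF.1 hH'
    obtain ⟨c, hc⟩ := exists_smul_of_ker_le ((hres H₁ hH₁).trans (hres H' hH').symm).le
    have hc0 : c ≠ 0 := by
      rintro rfl
      exact hne H' hH' (by rw [hc, zero_smul])
    obtain ⟨e, he⟩ : ∃ e : K, formOf H' - c • formOf H₁ = e • α := by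
      refine exists_smul_of_ker_le fun x hx => ?_
      have := LinearMap.congr_fun hc ⟨x, hα ▸ hx⟩
      simpa [sub_eq_zero] using this
    have hform : Poly.form K V (formOf H') =
        c • Poly.form K V (formOf H₁) + e • Poly.form K V α := by
      rw [← map_smul, ← map_smul, ← map_add, ← he, add_sub_cancel]
    have hθ' := (A'.mem_derivations_iff θ).1 hθ (formOf H') (by rwa [A'.ker_formOf h1])
    have key : algebraMap K (Poly K V) c *
        (Poly.form K V α * θ (Poly.form K V (formOf H₁)) -
          Poly.form K V (formOf H₁) * θ (Poly.form K V α)) =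
        Poly.form K V α * θ (Poly.form K V (formOf H')) -
          Poly.form K V (formOf H') * θ (Poly.form K V α) := by
      rw [hform]
      simp only [map_add, Derivation.map_smul]
      simp only [Algebra.smul_def]
      ring
    rw [← ((IsUnit.mk0 _ hc0).map (algebraMap K (Poly K V))).dvd_mul_left, key]
    exact dvd_sub (hθ'.mul_left _) (dvd_mul_right _ _)
  have hprod : ∏ H' ∈ F Y, Poly.form K V (formOf H') ∣
      Poly.form K V α * θ (Poly.form K V (formOf H₁)) -
        Poly.form K V (formOf H₁) * θ (Poly.form K V α) := by
    refine Finset.prod_dvd_of_isRelPrime (fun H' hH' H'' hH'' hn => ?_) hdvd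
    have h1 := (hF.1 hH').1
    have h2 := (hF.1 hH'').1
    refine isRelPrime_form (A'.formOf_ne_zero h1) fun hd => hn ?_
    rw [← A'.ker_formOf h1, ← A'.ker_formOf h2]
    exact ker_eq_of_form_dvd (A'.formOf_ne_zero h1) (A'.formOf_ne_zero h2) hd
  -- On `H` the term with factor `α` vanishes and every form of `F Y` becomes associated to `α_Y`;
  -- cancelling one such factor leaves the exponent `|F Y| - 1`.
  have hprod' := map_dvd (Poly.pullback H.subtype) hprod
  rw [map_prod, map_sub, map_mul, hs.pullback_self, zero_mul, zero_sub, map_mul, dvd_neg] at hprod'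
  have hpow : Poly.form K H (formOf Y) ^ (F Y).card ∣
      ∏ H' ∈ F Y, Poly.pullback H.subtype (Poly.form K V (formOf H')) := by
    rw [← Finset.prod_const]
    refine Finset.prod_dvd_prod_of_dvd _ _ fun H' hH' => ?_
    rw [Poly.pullback_form]
    exact (associated_form_of_ker_eq (hne H' hH') (hres H' hH').symm).dvd
  have hfin := (hpow.trans hprod').trans (mul_dvd_mul_right
    (a := Poly.pullback H.subtype (Poly.form K V (formOf H₁))) (b := Poly.form K H (formOf Y))
    (by
      rw [Poly.pullback_form]
      exact (associated_form_of_ker_eq hγ0 (hres H₁ hH₁)).dvd) _)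
  rw [← Nat.sub_add_cancel hpos, pow_succ', mul_dvd_mul_iff_left (prime_form hγ0).ne_zero] at hfin
  exact hfin

end Restriction

end Arrangement

namespace Arrangement

/-! ### A graded exchange lemma -/

section GradedExchange

variable {K : Type u} [Field K] {R : Type*} [CommRing R] [Algebra K R] {M : Type*} [AddCommGroup M]
  [Module R M] {ι κ : Type*} [Fintype ι] [Fintype κ]

open Module

/-- Suppose that the `v i` of degrees `b i` are homogeneous combinations of the `φ j` of
degrees `a j`, and that there are at least as many `v i` as `φ j` in each degree and more of them in
some degree. Then some `v i` is a combination of the others. -/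
theorem exists_mem_span_others {v : ι → M} {φ : κ → M} {b : ι → ℕ} {a : κ → ℕ} {c : ι → κ → R}
    (hv : ∀ i, v i = ∑ j, c i j • φ j) (hlt : ∀ i j, b i < a j → c i j = 0)
    (heq : ∀ i j, b i = a j → ∃ x : K, algebraMap K R x = c i j)
    (hcount : ∀ t, Fintype.card {j // a j = t} ≤ Fintype.card {i // b i = t})
    {m : ℕ} (hm : Fintype.card {j // a j = m} < Fintype.card {i // b i = m}) :
    ∃ i, v i ∈ Submodule.span R (v '' {i}ᶜ) := by
  classical
  by_contra! hno
  have hC : ∀ t, ∃ C : {i // b i = t} → {j // a j = t} → K,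
      ∀ i j, algebraMap K R (C i j) = c i j := by
    intro t
    choose C hC using fun (i : {i // b i = t}) (j : {j // a j = t}) =>
      heq i j (i.2.trans j.2.symm)
    exact ⟨C, hC⟩
  choose C hC using hC
  -- Induction on the degree `t`: suppose the `φ j` of degree below `t` lie in `L t`. Modulo `L t`,
  -- the `v i` of degree `t` are scalar combinations, with matrix `C t`, of the `φ j` of the same
  -- degree.
  let L : ℕ → Submodule R M := fun t => Submodule.span R (v '' {i | b i < t})
  have hcomb : ∀ t, (∀ j, a j < t → φ j ∈ L t) → ∀ g : {i // b i = t} → K,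
      ∑ i, algebraMap K R (g i) • v i - ∑ j, algebraMap K R (∑ i, g i * C t i j) • φ j ∈ L t := by
    intro t ht g
    have h1 : ∀ i : {i // b i = t}, v i - ∑ j : {j // a j = t}, c i j • φ j ∈ L t := by
      intro i
      rw [hv, ← Fintype.sum_subtype_add_sum_subtype (fun j => a j = t), add_sub_cancel_left]
      refine Submodule.sum_mem _ fun j _ => ?_
      rcases lt_or_gt_of_ne j.2 with hj | hj
      · exact Submodule.smul_mem _ _ (ht j hj)
      · rw [hlt i j (i.2.trans_lt hj), zero_smul]
        exact Submodule.zero_mem _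
    have h2 : ∑ i, algebraMap K R (g i) • v i -
        ∑ j, algebraMap K R (∑ i, g i * C t i j) • φ j =
        ∑ i : {i // b i = t}, algebraMap K R (g i) •
          (v i - ∑ j : {j // a j = t}, c i j • φ j) := by
      simp only [smul_sub, Finset.sum_sub_distrib, Finset.smul_sum, map_sum, Finset.sum_smul,
        map_mul, hC, mul_smul]
      rw [Finset.sum_comm]
    rw [h2]
    exact Submodule.sum_mem _ fun i _ => Submodule.smul_mem _ _ (h1 i)
  -- A relation between rows of `C t` would put some `v i` into the span of the others. So the rows
  -- are independent, and by the count `C t` is square and invertible, which carries the induction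
  -- on; in degree `m` there are too many rows.
  have hrows : ∀ t, (∀ j, a j < t → φ j ∈ L t) → LinearIndependent K (C t) := by
    intro t ht
    rw [Fintype.linearIndependent_iff]
    intro g hg i
    by_contra hgi
    have h1 := hcomb t ht g
    have h2 : ∀ j, ∑ i, g i * C t i j = 0 := fun j => by
      simpa using congrFun hg j
    simp only [h2, map_zero, zero_smul, Finset.sum_const_zero, sub_zero] at h1
    have hLle : L t ≤ Submodule.span R (v '' {(i : ι)}ᶜ) := by
      refine Submodule.span_mono (Set.image_mono fun k hk => ?_)
      rintro rfl
      exact absurd i.2 (ne_of_lt hk)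
    have h3 := hLle h1
    rw [← Finset.add_sum_erase _ _ (Finset.mem_univ i)] at h3
    have hrest : ∑ k ∈ Finset.univ.erase i, algebraMap K R (g k) • v k ∈
        Submodule.span R (v '' {(i : ι)}ᶜ) :=
      Submodule.sum_mem _ fun k hk => Submodule.smul_mem _ _ (Submodule.subset_span
        ⟨k, fun h => (Finset.mem_erase.1 hk).1 (Subtype.ext h), rfl⟩)
    have h4 := (Submodule.add_mem_iff_left _ hrest).1 h3
    refine hno i ?_
    have h5 := Submodule.smul_mem _ (algebraMap K R (g i)⁻¹) h4
    rwa [smul_smul, ← map_mul, inv_mul_cancel₀ hgi, map_one, one_smul] at h5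
  have hle : ∀ t, (∀ j, a j < t → φ j ∈ L t) →
      Fintype.card {i // b i = t} ≤ Fintype.card {j // a j = t} := by
    intro t ht
    simpa using (hrows t ht).fintype_card_le_finrank
  have hmem : ∀ t, ∀ j, a j < t → φ j ∈ L t := by
    intro t
    induction t with
    | zero => intro j hj; omega
    | succ t ih =>
      intro j hj
      have hL : L t ≤ L (t + 1) :=
        Submodule.span_mono (Set.image_mono fun k (hk : b k < t) => Nat.lt_succ_of_lt hk)
      rcases Nat.lt_succ_iff_lt_or_eq.1 hj with hj | hj
      · exact hL (ih j hj)
      have hspan := (hrows t ih).span_eq_top_of_card_eq_finrank'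
        (by simpa using le_antisymm (hle t ih) (hcount t))
      have h1 : Pi.single (⟨j, hj⟩ : {j // a j = t}) (1 : K) ∈
          Submodule.span K (Set.range (C t)) := hspan ▸ Submodule.mem_top
      obtain ⟨g, hg⟩ := (Submodule.mem_span_range_iff_exists_fun K).1 h1
      have h2 := hcomb t ih g
      have h3 : ∀ k, ∑ i, g i * C t i k =
          (Pi.single (⟨j, hj⟩ : {j // a j = t}) (1 : K) : {j // a j = t} → K) k := fun k => by
        rw [← hg]
        simp
      have h4 : ∑ k, algebraMap K R (∑ i, g i * C t i k) • φ k = φ j := by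
        simp only [h3]
        rw [Finset.sum_eq_single ⟨j, hj⟩]
        · simp
        · intro k _ hk
          simp [hk]
        · simp
      rw [h4] at h2
      rw [← sub_sub_cancel (∑ i, algebraMap K R (g i) • v i) (φ j)]
      refine Submodule.sub_mem _ (Submodule.sum_mem _ fun i _ => Submodule.smul_mem _ _
        (Submodule.subset_span ⟨i, ?_, rfl⟩)) (hL h2)
      exact i.2.trans_lt (Nat.lt_succ_self t)
  exact absurd (hle m (hmem m)) (not_le.2 hm)

end GradedExchange

/-! ### Terao's addition and deletion theorems -/

section AdditionDeletion

variable {K : Type u} [Field K] {V : Type v} [AddCommGroup V] [Module K V]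

open Module

/-- Each `c j` is replaced by its component of degree `m - a j`. Coefficients that were zero stay
zero. -/
theorem exists_homogeneous_coeff {κ : Type*} [Fintype κ] {η : Der K V} {φ : κ → Der K V} {m : ℕ}
    {a : κ → ℕ} (hη : IsHomogeneousDer η m) (hφ : ∀ j, IsHomogeneousDer (φ j) (a j))
    (c : κ → Poly K V) (h : η = ∑ j, c j • φ j) :
    ∃ c' : κ → Poly K V, η = ∑ j, c' j • φ j ∧
      ∀ j, c' j ≠ 0 → c j ≠ 0 ∧ a j ≤ m ∧ c' j ∈ homogeneousPart K V (m - a j) := by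
  refine ⟨fun j => if a j ≤ m then (gradeHom K V (c j)).coeff (m - a j) else 0,
    der_ext fun β => ?_, fun j hj => ?_⟩
  · have h1 := congrArg (gradeHom K V) (DFunLike.congr_fun h (Poly.form K V β))
    rw [gradeHom_of_mem (hη β), der_sum_smul_apply, map_sum] at h1
    have h2 := congrArg (fun f => f.coeff m) h1
    simp only [Polynomial.finsetSum_coeff, map_mul, gradeHom_of_mem (hφ _ β),
      Polynomial.coeff_C_mul_X_pow, if_true] at h2
    rw [h2, der_sum_smul_apply]
    refine Finset.sum_congr rfl fun j _ => ?_
    rw [← mul_assoc]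
    split_ifs with hj
    · conv_lhs => rw [← Nat.sub_add_cancel hj]
      rw [Polynomial.coeff_mul_X_pow, Polynomial.coeff_mul_C]
    · rw [zero_mul, Polynomial.coeff_mul_X_pow', if_neg hj]
  · dsimp only at hj ⊢
    split_ifs at hj ⊢ with hle
    · refine ⟨?_, hle, coeff_gradeHom_mem _ _⟩
      intro h0
      simp [h0] at hj
    · exact absurd rfl hj

theorem IsHomogeneousDer.smul {θ : Der K V} {p q : ℕ} {s : Poly K V} (hθ : IsHomogeneousDer θ q)
    (hs : s ∈ homogeneousPart K V p) : IsHomogeneousDer (s • θ) (p + q) := fun x =>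
  mul_mem_homogeneousPart hs (hθ x)

theorem IsHomogeneousDer.sub {θ η : Der K V} {p : ℕ} (hθ : IsHomogeneousDer θ p)
    (hη : IsHomogeneousDer η p) : IsHomogeneousDer (θ - η) p := fun x =>
  Submodule.sub_mem _ (hθ x) (hη x)

theorem IsHomogeneousDer.sum {κ : Type*} (s : Finset κ) {θ : κ → Der K V} {p : ℕ}
    (hθ : ∀ i ∈ s, IsHomogeneousDer (θ i) p) : IsHomogeneousDer (∑ i ∈ s, θ i) p := fun x => by
  have : (∑ i ∈ s, θ i) (Poly.form K V x) = ∑ i ∈ s, θ i (Poly.form K V x) := by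
    simpa using der_sum_smul_apply s (fun _ => 1) θ (Poly.form K V x)
  rw [this]
  exact Submodule.sum_mem _ fun i hi => hθ i hi x

theorem exists_smul_der_of_dvd {s : Poly K V} (hs : s ≠ 0) {θ : Der K V}
    (h : ∀ β, s ∣ θ (Poly.form K V β)) : ∃ η : Der K V, s • η = θ := by
  choose f hf using h
  refine ⟨mkDer { toFun := f, map_add' := fun a b => ?_, map_smul' := fun c a => ?_ },
    der_ext fun β => ?_⟩
  · apply mul_left_cancel₀ hs
    rw [← hf, mul_add, ← hf, ← hf, map_add, map_add]
  · apply mul_left_cancel₀ hs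
    rw [← hf, RingHom.id_apply, mul_smul_comm, ← hf, map_smul, Derivation.map_smul]
  · rw [Derivation.smul_apply, mkDer_form, smul_eq_mul]
    exact (hf β).symm

theorem IsHomogeneousDer.of_smul {s : Poly K V} (hs : s ≠ 0) {η : Der K V} {p q : ℕ}
    (h : IsHomogeneousDer (s • η) p) (hsq : s ∈ homogeneousPart K V q) (hη : η ≠ 0) :
    q ≤ p ∧ IsHomogeneousDer η (p - q) := by
  have key : ∀ β, η (Poly.form K V β) ≠ 0 →
      q ≤ p ∧ η (Poly.form K V β) ∈ homogeneousPart K V (p - q) := fun β hβ =>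
    mem_homogeneousPart_of_mul hβ hs (by rw [mul_comm]; exact h β) hsq
  constructor
  · by_contra hlt
    refine hη (der_ext fun β => ?_)
    by_contra hβ
    exact hlt (key β hβ).1
  · intro β
    by_cases hβ : η (Poly.form K V β) = 0
    · rw [hβ]; exact Submodule.zero_mem _
    · exact (key β hβ).2

/-- By linearity of the determinant in row `i`, `s` times the new determinant is `c i` times the old
one. -/
theorem linearIndependent_update {ι : Type*} [Fintype ι] [DecidableEq ι] (b : Basis ι K V)
    {θ : ι → Der K V} (hli : LinearIndependent (Poly K V) θ) {s : Poly K V} {η : Der K V}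
    {c : ι → Poly K V} (h : s • η = ∑ j, c j • θ j) {i : ι} (hi : c i ≠ 0) :
    LinearIndependent (Poly K V) (Function.update θ i η) := by
  rw [← det_saitoMatrix_ne_zero_iff b] at hli ⊢
  have hrow : ∀ η', saitoMatrix b (Function.update θ i η') =
      (saitoMatrix b θ).updateRow i (derEquiv b η') := by
    intro η'
    ext k l
    by_cases hk : k = i
    · subst hk; simp
    · simp [hk]
  have h1 : s * (saitoMatrix b (Function.update θ i η)).det = c i * (saitoMatrix b θ).det := by
    rw [hrow, ← Matrix.det_updateRow_smul, ← map_smul, h, map_sum]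
    simp only [map_smul]
    exact Matrix.det_updateRow_sum _ _ _
  intro h0
  rw [h0, mul_zero] at h1
  exact mul_ne_zero hi hli h1.symm

theorem derivations_le_deletion (A : Arrangement K V) (H : Submodule K V) :
    A.derivations ≤ (A.deletion H).derivations := fun _ h α hα => h α hα.1

theorem smul_form_mem_derivations (A : Arrangement K V) {H : Submodule K V} {α : Dual K V}
    (hα : H = LinearMap.ker α) {θ : Der K V} (hθ : θ ∈ (A.deletion H).derivations) :
    Poly.form K V α • θ ∈ A.derivations := by
  rw [mem_derivations_iff] at hθ ⊢
  intro β hβ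
  by_cases h : LinearMap.ker β = H
  · exact form_dvd_der_of_ker_eq (hα.symm.trans h.symm) (dvd_mul_right _ _)
  · exact (hθ β ⟨hβ, h⟩).mul_left _

theorem mem_derivations_of_deletion (A : Arrangement K V) {H : Submodule K V} {α : Dual K V}
    (hα : H = LinearMap.ker α) {θ : Der K V} (hθ : θ ∈ (A.deletion H).derivations)
    (h : Poly.form K V α ∣ θ (Poly.form K V α)) : θ ∈ A.derivations := by
  rw [mem_derivations_iff] at hθ ⊢
  intro β hβ
  by_cases hk : LinearMap.ker β = H
  · exact form_dvd_der_of_ker_eq (hα.symm.trans hk.symm) h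
  · exact hθ β ⟨hβ, hk⟩

theorem mem_deletion_of_smul_form_mem (A : Arrangement K V) {H : Submodule K V} {α : Dual K V}
    (hα0 : α ≠ 0) (hα : H = LinearMap.ker α) {θ : Der K V}
    (hθ : Poly.form K V α • θ ∈ (A.deletion H).derivations) :
    θ ∈ (A.deletion H).derivations := by
  rw [mem_derivations_iff] at hθ ⊢
  intro β hβ
  refine form_dvd_of_dvd_mul ((A.deletion H).ne_zero_of_ker_mem hβ) hα0 (fun h => hβ.2 ?_)
    (hθ β hβ)
  exact h.trans hα.symm

variable [FiniteDimensional K V]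

theorem finrank_hyperplane_add_one (A : Arrangement K V) {H : Submodule K V}
    (hH : H ∈ A.hyperplanes) : finrank K H + 1 = finrank K V := by
  obtain ⟨α, hα, rfl⟩ := A.isHyperplane H hH
  exact Dual.finrank_ker_add_one_of_ne_zero hα

theorem exists_eq_add_singleton {κ ι : Type*} [Fintype κ] [Fintype ι] {a : κ → ℕ} {d : ι → ℕ}
    (hle : (Finset.univ : Finset κ).val.map a ≤ (Finset.univ : Finset ι).val.map d)
    (hcard : Fintype.card κ + 1 = Fintype.card ι) :
    ∃ m, (Finset.univ : Finset ι).val.map d = (Finset.univ : Finset κ).val.map a + {m} ∧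
      ∑ i, d i = ∑ j, a j + m := by
  obtain ⟨c, hc⟩ := Multiset.le_iff_exists_add.1 hle
  have h1 := congrArg Multiset.card hc
  simp only [Multiset.card_map, Multiset.card_add, Finset.card_val, Finset.card_univ] at h1
  obtain ⟨m, rfl⟩ := Multiset.card_eq_one.1 (show Multiset.card c = 1 by omega)
  refine ⟨m, hc, ?_⟩
  have := congrArg Multiset.sum hc
  simpa using this

theorem countP_add_singleton (s : Multiset ℕ) (m : ℕ) (p : ℕ → Prop) [DecidablePred p] :
    (s + {m}).countP p = s.countP p + if p m then 1 else 0 := by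
  rw [Multiset.countP_add, ← Multiset.cons_zero, Multiset.countP_cons, Multiset.countP_zero,
    zero_add]

theorem card_subtype_eq_countP {ι : Type*} [Fintype ι] (d : ι → ℕ) (p : ℕ → Prop)
    [DecidablePred p] :
    Fintype.card {i // p (d i)} = ((Finset.univ : Finset ι).val.map d).countP p := by
  rw [Fintype.card_subtype, Multiset.countP_map]
  rfl

/-- Among the basis elements of `D(A')` of the one degree not accounted for by `A''`, some `θ k` has
`θ k α` equal on `H` to a nonzero scalar times Terao's polynomial. Subtracting multiples of it moves
the others into `D(A)`, and `α • θ k` completes the basis. -/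
theorem isFree_of_addition (A : Arrangement K V) {H : Submodule K V} (hH : H ∈ A.hyperplanes)
    (hexp : (A.restriction H).ExponentsSubset (A.deletion H)) : A.IsFree := by
  classical
  obtain ⟨α, hα0, hα⟩ := A.isHyperplane H hH
  obtain ⟨p, v, hs⟩ := exists_isHyperplaneSplitting hα0 hα
  obtain ⟨e, e', hfree, hfree', hle⟩ := hexp
  let b := Module.finBasis K V
  obtain ⟨θ, d, hd, rfl, hsum⟩ := hfree'.exists_basis b
  obtain ⟨φ, a, ha, rfl, hsum'⟩ := hfree.exists_basis (Module.finBasis K H)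
  obtain ⟨m, hm, hsm⟩ := exists_eq_add_singleton hle
    (by simpa using A.finrank_hyperplane_add_one hH)
  obtain ⟨m', B, hB, hB0, hBm, hdvd⟩ := A.exists_dvd_restrict_form hα hH
  -- The exponents of `A'` and `A''` sum to their cardinalities, so the extra exponent is the degree
  -- of Terao's polynomial.
  obtain rfl : m' = m := by omega
  have hndvd := (A.deletion H).not_form_dvd_det b θ hα0 fun h => h.2 hα.symm
  choose f hf using fun i => hdvd _ (θ i).2
  have hdeg : ∀ i, f i ≠ 0 → m' ≤ d i ∧ f i ∈ homogeneousPart K H (d i - m') := fun i hi => by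
    refine mem_homogeneousPart_of_mul hi hB0 ?_ hBm
    rw [mul_comm, ← hf i]
    exact pullback_mem_homogeneousPart _ (hd i α)
  by_cases hcase : ∃ k, d k = m' ∧ f k ≠ 0
  · obtain ⟨k, hk, hfk⟩ := hcase
    obtain ⟨c, hc⟩ := exists_of_mem_homogeneousPart_zero (s := f k)
      (by simpa [hk] using (hdeg k hfk).2)
    have hc0 : c ≠ 0 := by
      rintro rfl
      exact hfk (by rw [← hc, map_zero])
    -- On `H`, `θ i α = B * f i` and `θ k α = B * c`, so subtracting `c⁻¹ • f i` times `θ k` makes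
    -- the value at `α` vanish there.
    let g : Fin (finrank K V) → Poly K V := fun i =>
      if i = k then 0 else c⁻¹ • Poly.pullback p (f i)
    let η : Fin (finrank K V) → Der K V := fun i => (θ i : Der K V) - g i • (θ k : Der K V)
    have hηk : η k = θ k := by simp [η, g]
    have hηli : LinearIndependent (Poly K V) η := by
      have h1 := (det_saitoMatrix_ne_zero_iff b _).2 (linearIndependent_coe_basis θ)
      rw [← det_saitoMatrix_ne_zero_iff b]
      rw [← Matrix.det_eq_of_forall_row_eq_smul_add_const (A := saitoMatrix b η)
        (fun i => -g i) k (by simp [g]) fun i j => by simp [η, sub_eq_add_neg]] at h1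
      exact h1
    have hηhom : ∀ i, IsHomogeneousDer (η i) (d i) := by
      intro i
      refine (hd i).sub ?_
      by_cases hfi : f i = 0
      · intro x
        simp [g, hfi]
      · have h1 : g i ∈ homogeneousPart K V (d i - m') := by
          by_cases hik : i = k
          · simp [g, hik]
          · simp only [g, if_neg hik]
            exact Submodule.smul_mem _ _ (pullback_mem_homogeneousPart p (hdeg i hfi).2)
        have h2 := (hd k).smul h1
        rwa [hk, Nat.sub_add_cancel (hdeg i hfi).1] at h2
    have hηmem' : ∀ i, η i ∈ (A.deletion H).derivations := fun i =>
      Submodule.sub_mem _ (θ i).2 (Submodule.smul_mem _ _ (θ k).2)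
    have hηmem : ∀ i, i ≠ k → η i ∈ A.derivations := by
      intro i hi
      refine A.mem_derivations_of_deletion hα (hηmem' i) ((hs.pullback_eq_zero_iff _).1 ?_)
      rw [Derivation.sub_apply, Derivation.smul_apply, map_sub, smul_eq_mul, map_mul, hf i, hf k]
      simp only [g, if_neg hi, map_smul, hs.pullback_pullback_proj, ← hc]
      rw [Algebra.smul_def, mul_comm B (algebraMap K _ c), ← mul_assoc,
        mul_right_comm (algebraMap K (Poly K H) c⁻¹), ← map_mul, inv_mul_cancel₀ hc0, map_one,
        one_mul, mul_comm, sub_self]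
    refine ⟨_, A.isFreeWithExponents_of_sum_degrees_le b
      (θ := Function.update η k (Poly.form K V α • (θ k : Der K V)))
      (d := Function.update d k (d k + 1)) (fun i => ?_) (fun i => ?_) ?_ ?_⟩
    · by_cases hi : i = k
      · subst hi
        simpa using A.smul_form_mem_derivations hα (θ i).2
      · simpa [hi] using hηmem i hi
    · by_cases hi : i = k
      · subst hi
        simpa [add_comm] using (hd i).smul (form_mem_homogeneousPart α)
      · simpa [hi] using hηhom i
    · refine linearIndependent_update b hηli (s := 1) (c := Pi.single k (Poly.form K V α)) ?_
        (by simpa using (prime_form hα0).ne_zero)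
      rw [one_smul, Finset.sum_eq_single k (by intro i _ hi; simp [hi]) (by simp),
        Pi.single_eq_same, hηk]
    · have h1 := A.card_deletion_add_one hH
      rw [Finset.sum_update_of_mem (Finset.mem_univ k), Finset.sdiff_singleton_eq_erase]
      have h2 := Finset.add_sum_erase Finset.univ d (Finset.mem_univ k)
      omega
  · push Not at hcase
    -- Below degree `m'` the cofactor vanishes for degree reasons, and in degree `m'` by the case
    -- assumption. All these `θ i` therefore lie in `D(A)` and restrict to `D(A'')`.
    have hlow : ∀ i : {i // d i ≤ m'}, f i = 0 := by
      intro i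
      by_contra hi
      exact hi (hcase i (le_antisymm i.2 (hdeg i hi).1))
    have hαd : ∀ i : {i // d i ≤ m'},
        Poly.form K V α ∣ (θ i : Der K V) (Poly.form K V α) := fun i => by
      rw [← hs.pullback_eq_zero_iff, hf, hlow, mul_zero]
    have hli := hs.linearIndependent_restrictDer b hndvd
      (fun i : {i // d i ≤ m'} => (i : Fin _)) Subtype.val_injective hαd
    have hspan : Set.range (fun i : {i // d i ≤ m'} => restrictDer H.subtype p (θ i : Der K V)) ≤
        Submodule.span (Poly K H) (Set.range fun j : {j // a j ≤ m'} => (φ j : Der K H)) := by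
      rintro _ ⟨i, rfl⟩
      have hmem := A.restrictDer_mem_derivations hα hs hH
        (A.mem_derivations_of_deletion hα (θ i).2 (hαd i))
      have hrepr := congrArg Subtype.val (φ.sum_repr ⟨_, hmem⟩)
      simp only [Submodule.coe_sum, Submodule.coe_smul] at hrepr
      obtain ⟨c, hc, hc'⟩ := exists_homogeneous_coeff ((hd i).restrictDer _ _) ha _ hrepr.symm
      change restrictDer H.subtype p (θ i : Der K V) ∈ _
      rw [hc]
      refine Submodule.sum_mem _ fun j _ => ?_
      by_cases hj : c j = 0
      · rw [hj, zero_smul]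
        exact Submodule.zero_mem _
      · exact Submodule.smul_mem _ _ (Submodule.subset_span
          ⟨⟨j, (hc' j hj).2.1.trans i.2⟩, rfl⟩)
    -- The restrictions are independent and lie in the span of the `φ j` of degree at most `m'`, but
    -- there is one more of them than of these `φ j`.
    have h1 := linearIndependent_le_span_aux' _ hli _ hspan
    have h2 := h1.trans (Fintype.card_range_le _)
    rw [card_subtype_eq_countP d (· ≤ m'), card_subtype_eq_countP a (· ≤ m'), hm,
      countP_add_singleton] at h2
    simp at h2

/-- The restrictions of a basis of `D(A)` to `H` exceed a basis of `D(A'')` by one in degree `m`, so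
by exchange one of them depends on the others. Lifting the relation gives an element of `D(A)`
divisible by `α`; its quotient replaces a basis element and lowers the degree sum by one. -/
theorem isFree_of_deletion (A : Arrangement K V) {H : Submodule K V} (hH : H ∈ A.hyperplanes)
    (hexp : (A.restriction H).ExponentsSubset A) : (A.deletion H).IsFree := by
  classical
  obtain ⟨α, hα0, hα⟩ := A.isHyperplane H hH
  obtain ⟨p, v, hs⟩ := exists_isHyperplaneSplitting hα0 hα
  obtain ⟨e, e', hfree, hfree', hle⟩ := hexp
  let b := Module.finBasis K V
  obtain ⟨θ, d, hd, rfl, hsum⟩ := hfree'.exists_basis b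
  obtain ⟨φ, a, ha, rfl, hsum'⟩ := hfree.exists_basis (Module.finBasis K H)
  obtain ⟨m, hm, hsm⟩ := exists_eq_add_singleton hle
    (by simpa using A.finrank_hyperplane_add_one hH)
  have hαd : ∀ i, Poly.form K V α ∣ (θ i : Der K V) (Poly.form K V α) := fun i =>
    (A.mem_derivations_iff _).1 (θ i).2 α (hα ▸ hH)
  let w : Fin (finrank K V) → Der K H := fun i => restrictDer H.subtype p (θ i : Der K V)
  have hw : ∀ i, IsHomogeneousDer (w i) (d i) := fun i => (hd i).restrictDer _ _
  have hcoeff : ∀ i, ∃ c : Fin (finrank K H) → Poly K H, w i = ∑ j, c j • (φ j : Der K H) ∧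
      ∀ j, c j ≠ 0 → a j ≤ d i ∧ c j ∈ homogeneousPart K H (d i - a j) := by
    intro i
    have hrepr := congrArg Subtype.val
      (φ.sum_repr ⟨w i, A.restrictDer_mem_derivations hα hs hH (θ i).2⟩)
    simp only [Submodule.coe_sum, Submodule.coe_smul] at hrepr
    obtain ⟨c, hc, hc'⟩ := exists_homogeneous_coeff (hw i) ha _ hrepr.symm
    exact ⟨c, hc, fun j hj => (hc' j hj).2⟩
  choose c hc hc' using hcoeff
  have hcount : ∀ t, Fintype.card {i // d i = t} =
      Fintype.card {j // a j = t} + if m = t then 1 else 0 := by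
    intro t
    rw [card_subtype_eq_countP d (· = t), card_subtype_eq_countP a (· = t), hm,
      countP_add_singleton]
  obtain ⟨k, hk⟩ : ∃ k, w k ∈ Submodule.span (Poly K H) (w '' {k}ᶜ) := by
    refine exists_mem_span_others (K := K) (b := d) (a := a) hc (fun i j hij => ?_)
      (fun i j hij => ?_) (fun t => ?_) (m := m) ?_
    · by_contra h
      exact absurd (hc' i j h).1 (not_le.2 hij)
    · by_cases h : c i j = 0
      · exact ⟨0, by rw [h, map_zero]⟩
      · refine exists_of_mem_homogeneousPart_zero ?_
        simpa [hij] using (hc' i j h).2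
    · rw [hcount]
      exact Nat.le_add_right _ _
    · rw [hcount, if_pos rfl]
      exact Nat.lt_succ_self _
  obtain ⟨g₀, hg₀, hg₀k⟩ : ∃ g : Fin (finrank K V) → Poly K H,
      w k = ∑ i, g i • w i ∧ g k = 0 := by
    rw [Finsupp.mem_span_image_iff_linearCombination] at hk
    obtain ⟨l, hl, hlk⟩ := hk
    refine ⟨l, ?_, ?_⟩
    · rw [← hlk, Finsupp.linearCombination_apply, Finsupp.sum_fintype _ _ (by simp)]
    · by_contra h
      exact (Finsupp.mem_supported _ _).1 hl (Finsupp.mem_support_iff.2 h) rfl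
  -- Making the coefficients homogeneous keeps `g k = 0`, so `θ k` enters `ξ` with coefficient `1`
  -- and can be exchanged for `η`.
  obtain ⟨g, hg, hg'⟩ := exists_homogeneous_coeff (hw k) hw g₀ hg₀
  have hgk : g k = 0 := by
    by_contra h
    exact (hg' k h).1 hg₀k
  let c' : Fin (finrank K V) → Poly K V := fun i =>
    (if i = k then 1 else 0) - Poly.pullback p (g i)
  let ξ : Der K V := ∑ i, c' i • (θ i : Der K V)
  have hξ : ξ = (θ k : Der K V) - ∑ i, Poly.pullback p (g i) • (θ i : Der K V) := by
    simp [ξ, c', sub_smul, Finset.sum_sub_distrib, ite_smul]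
  have hξmem : ξ ∈ A.derivations :=
    Submodule.sum_mem _ fun i _ => Submodule.smul_mem _ _ (θ i).2
  have hξdvd : ∀ β, Poly.form K V α ∣ ξ (Poly.form K V β) := by
    intro β
    rw [← hs.pullback_eq_zero_iff, hξ, Derivation.sub_apply, der_sum_smul_apply, map_sub, map_sum]
    simp only [map_mul, hs.pullback_pullback_proj, ← hs.restrictDer_form_comp (hαd _) β]
    change w k _ - ∑ i, g i * w i _ = 0
    conv_lhs => rw [hg]
    rw [der_sum_smul_apply, sub_self]
  have hξhom : IsHomogeneousDer ξ (d k) := by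
    rw [hξ]
    refine (hd k).sub (IsHomogeneousDer.sum _ fun i _ => ?_)
    by_cases hi : g i = 0
    · intro x
      simp [hi]
    · have h1 := (hd i).smul (pullback_mem_homogeneousPart p (hg' i hi).2.2)
      rwa [Nat.sub_add_cancel (hg' i hi).2.1] at h1
  have hα1 := (prime_form hα0).ne_zero
  obtain ⟨η, hη⟩ := exists_smul_der_of_dvd hα1 hξdvd
  have hli := linearIndependent_update b (linearIndependent_coe_basis θ) (i := k) (c := c') hη
    (by simp [c', hgk])
  have hη0 : η ≠ 0 := by
    have := hli.ne_zero k
    simpa using this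
  -- `hd1` gives `1 ≤ d k`, so `d k - 1` below is a true difference.
  obtain ⟨hd1, hηhom⟩ := IsHomogeneousDer.of_smul hα1 (hη ▸ hξhom) (form_mem_homogeneousPart α) hη0
  refine ⟨_, (A.deletion H).isFreeWithExponents_of_sum_degrees_le b
    (d := Function.update d k (d k - 1)) (fun i => ?_) (fun i => ?_) hli ?_⟩
  · by_cases hi : i = k
    · subst hi
      simpa using A.mem_deletion_of_smul_form_mem hα0 hα
        (hη ▸ A.derivations_le_deletion H hξmem)
    · simpa [hi] using A.derivations_le_deletion H (θ i).2
  · by_cases hi : i = k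
    · subst hi
      simpa using hηhom
    · simpa [hi] using hd i
  · have h1 := A.card_deletion_add_one hH
    rw [Finset.sum_update_of_mem (Finset.mem_univ k), Finset.sdiff_singleton_eq_erase]
    have h2 := Finset.add_sum_erase Finset.univ d (Finset.mem_univ k)
    omega

end AdditionDeletion

end Arrangement

namespace Arrangement

/-! ### Exponents of the restriction when `A` and `A'` are free -/

section Exponents

variable {K : Type u} [Field K] {V : Type v} [AddCommGroup V] [Module K V]

open Module

theorem map_comp_le_map {ι κ : Type*} [Fintype ι] [Fintype κ] {f : κ → ι}
    (hf : Function.Injective f) (d : ι → ℕ) :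
    (Finset.univ : Finset κ).val.map (d ∘ f) ≤ (Finset.univ : Finset ι).val.map d := by
  rw [← Multiset.map_map]
  exact Multiset.map_le_map (Finset.val_le_iff.2
    (Finset.subset_univ ((Finset.univ : Finset κ).map ⟨f, hf⟩)))

variable [FiniteDimensional K V]

/-- If `A` and `A'` are free, then so is `A''`, and its exponents are exponents of both. -/
theorem exponentsSubset_of_isFree (A : Arrangement K V) {H : Submodule K V}
    (hH : H ∈ A.hyperplanes) (hA : A.IsFree) (hA' : (A.deletion H).IsFree) :
    (A.restriction H).ExponentsSubset (A.deletion H) ∧ (A.restriction H).ExponentsSubset A := by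
  classical
  obtain ⟨α, hα0, hα⟩ := A.isHyperplane H hH
  obtain ⟨p, v, hs⟩ := exists_isHyperplaneSplitting hα0 hα
  let b := Module.finBasis K V
  obtain ⟨e, he⟩ := hA
  obtain ⟨e', he'⟩ := hA'
  obtain ⟨θ, d, hd, rfl, hsum⟩ := he.exists_basis b
  obtain ⟨θ', d', hd', rfl, hsum'⟩ := he'.exists_basis b
  have hα1 := (prime_form hα0).ne_zero
  have hcard := A.card_deletion_add_one hH
  have hcoeff : ∀ j, ∃ c : Fin (finrank K V) → Poly K V,
      Poly.form K V α • (θ' j : Der K V) = ∑ i, c i • (θ i : Der K V) ∧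
      ∀ i, c i ≠ 0 → d i ≤ d' j + 1 := by
    intro j
    have hrepr := congrArg Subtype.val
      (θ.sum_repr ⟨_, A.smul_form_mem_derivations hα (θ' j).2⟩)
    simp only [Submodule.coe_sum, Submodule.coe_smul] at hrepr
    obtain ⟨c, hc, hc'⟩ := exists_homogeneous_coeff
      ((hd' j).smul (form_mem_homogeneousPart α)) hd _ hrepr.symm
    exact ⟨c, hc, fun i hi => (hc' i hi).2.1.trans_eq (add_comm _ _)⟩
  choose R hR hRd using hcoeff
  have hRdet : (Matrix.of R).det ≠ 0 := by
    intro h0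
    have hmul : (Matrix.of fun i j => Poly.form K V α *
        saitoMatrix b (fun i => (θ' i : Der K V)) i j) =
        Matrix.of R * saitoMatrix b fun i => (θ i : Der K V) := by
      ext i j
      have := DFunLike.congr_fun (hR i) (Poly.form K V (b.coord j))
      rw [der_sum_smul_apply] at this
      rw [Matrix.mul_apply]
      exact this
    have hdet := congrArg Matrix.det hmul
    rw [Matrix.det_mul_column (fun _ => Poly.form K V α), Matrix.det_mul, h0, zero_mul] at hdet
    exact mul_ne_zero (Finset.prod_ne_zero_iff.2 fun _ _ => hα1)
      ((det_saitoMatrix_ne_zero_iff b _).2 (linearIndependent_coe_basis θ')) hdet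
  -- A nonzero term of `det R` gives a permutation with `d i ≤ d' (σ i) + 1` throughout. Without
  -- equality somewhere, summing would give `|A| ≤ |A'|`.
  obtain ⟨k, j, hkj, hdk⟩ : ∃ k j, R j k ≠ 0 ∧ d k = d' j + 1 := by
    rw [Matrix.det_apply] at hRdet
    obtain ⟨σ, -, hσ⟩ := Finset.exists_ne_zero_of_sum_ne_zero hRdet
    have hσ' : ∀ i, R (σ i) i ≠ 0 := by
      intro i hi
      refine hσ ?_
      rw [Finset.prod_eq_zero (i := i) (Finset.mem_univ i) (by exact hi), smul_zero]
    by_contra! hne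
    have hle : ∑ i, d i ≤ ∑ i, d' (σ i) := Finset.sum_le_sum fun i _ =>
      Nat.lt_succ_iff.1 (lt_of_le_of_ne (hRd _ i (hσ' i)) (hne i (σ i) (hσ' i)))
    rw [Equiv.sum_comp σ d'] at hle
    omega
  -- `θ` and `ψ` are bases of `D(A)` and `D(A')` that differ only at `k`. The common elements
  -- restrict to the required basis of `D(A'')`.
  let ψ : Fin (finrank K V) → Der K V := Function.update (fun i => (θ i : Der K V)) k (θ' j)
  have hψli : LinearIndependent (Poly K V) ψ :=
    linearIndependent_update b (linearIndependent_coe_basis θ) (hR j) hkj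
  have hψhom : ∀ i, IsHomogeneousDer (ψ i) (Function.update d k (d' j) i) := by
    intro i
    by_cases hi : i = k
    · subst hi
      simpa [ψ] using hd' j
    · simpa [ψ, hi] using hd i
  have hψmem : ∀ i, ψ i ∈ (A.deletion H).derivations := by
    intro i
    by_cases hi : i = k
    · subst hi
      simp [ψ]
    · simpa [ψ, hi] using A.derivations_le_deletion H (θ i).2
  have herase := Finset.add_sum_erase Finset.univ d (Finset.mem_univ k)
  have hψsum : ∑ i, Function.update d k (d' j) i = (A.deletion H).card := by
    rw [Finset.sum_update_of_mem (Finset.mem_univ k), Finset.sdiff_singleton_eq_erase]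
    omega
  obtain ⟨B, hB⟩ := (A.deletion H).exists_basis_of_sum_degrees_le b hψmem hψhom hψli hψsum.le
  have hndvd := (A.deletion H).not_form_dvd_det b B hα0 fun h => h.2 hα.symm
  rw [show (fun i => (B i : Der K V)) = ψ from funext hB] at hndvd
  have hθα : ∀ i, Poly.form K V α ∣ (θ i : Der K V) (Poly.form K V α) := fun i =>
    (A.mem_derivations_iff _).1 (θ i).2 α (hα ▸ hH)
  have hψθ : ∀ i : {i // i ≠ k}, ψ i = θ i := fun i => by simp [ψ, i.2]
  have hψα : ∀ i : {i // i ≠ k}, Poly.form K V α ∣ ψ i (Poly.form K V α) := fun i => by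
    rw [hψθ]
    exact hθα i
  have hli := hs.linearIndependent_restrictDer b hndvd (fun i : {i // i ≠ k} => (i : Fin _))
    Subtype.val_injective hψα
  obtain ⟨m, P, hm, hP0, hPm, hdvd⟩ := A.exists_dvd_restrict_form hα hH
  -- Terao's polynomial bounds `d' j = d k - 1` below by `|A'| - |A''|`, so the degrees other than
  -- `d k` add up to at most `|A''|`.
  have hmle : m ≤ d' j := by
    obtain ⟨f, hf⟩ := hdvd _ (θ' j).2
    -- Otherwise `θ' j`, and with it all of `ψ`, would lie in `D(A)` with degree sum only `|A| - 1`.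
    have hf0 : f ≠ 0 := by
      rintro rfl
      rw [mul_zero, hs.pullback_eq_zero_iff] at hf
      have h1 := A.card_le_sum_degrees b (θ := ψ) (fun i => ?_) hψhom hψli
      · omega
      · by_cases hi : i = k
        · subst hi
          simpa [ψ] using A.mem_derivations_of_deletion hα (θ' j).2 hf
        · simp [ψ, hi]
    refine (mem_homogeneousPart_of_mul hf0 hP0 ?_ hPm).1
    rw [mul_comm, ← hf]
    exact pullback_mem_homogeneousPart _ (hd' j α)
  have hκ : Fintype.card {i // i ≠ k} = finrank K H := by
    have := A.finrank_hyperplane_add_one hH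
    rw [Fintype.card_subtype_compl, Fintype.card_subtype_eq, Fintype.card_fin]
    omega
  let bH : Basis {i : Fin (finrank K V) // i ≠ k} K H :=
    (Module.finBasis K H).reindex (Fintype.equivOfCardEq (by rw [hκ, Fintype.card_fin]))
  have hres := (A.restriction H).isFreeWithExponents_of_sum_degrees_le bH
    (θ := fun i => restrictDer H.subtype p (ψ i))
    (d := fun i => d i) (fun i => by
      rw [hψθ]
      exact A.restrictDer_mem_derivations hα hs hH (θ i).2) (fun i => by
      rw [hψθ]
      exact (hd i).restrictDer _ _) hli (by
      have h1 : ∑ i : {i // i ≠ k}, d i = ∑ i ∈ Finset.univ.erase k, d i :=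
        (Finset.sum_subtype _ (by simp) d).symm
      omega)
  have hdel := (A.deletion H).isFreeWithExponents_of_sum_degrees_le b hψmem hψhom hψli hψsum.le
  refine ⟨⟨_, _, hres, hdel, ?_⟩, ⟨_, _, hres, he, map_comp_le_map Subtype.val_injective d⟩⟩
  have h1 : (fun i : {i // i ≠ k} => d i) = Function.update d k (d' j) ∘ Subtype.val := by
    ext i
    simp [i.2]
  rw [h1]
  exact map_comp_le_map Subtype.val_injective _

end Exponents

/-! ### Freeness of products -/

section Product

variable {K : Type u} [Field K] {V₁ V₂ : Type v} [AddCommGroup V₁] [Module K V₁]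
  [AddCommGroup V₂] [Module K V₂]

open Module

theorem card_eq_ncard {V : Type v} [AddCommGroup V] [Module K V] (A : Arrangement K V) :
    A.card = A.hyperplanes.ncard :=
  (Set.ncard_eq_toFinset_card _ A.finite).symm

theorem prod_top_injective :
    Function.Injective fun H : Submodule K V₁ => H.prod (⊤ : Submodule K V₂) := by
  intro H H' h
  ext x
  simpa using SetLike.ext_iff.1 h (x, 0)

theorem top_prod_injective :
    Function.Injective fun H : Submodule K V₂ => (⊤ : Submodule K V₁).prod H := by
  intro H H' h
  ext x
  simpa using SetLike.ext_iff.1 h (0, x)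

theorem top_notMem {V : Type v} [AddCommGroup V] [Module K V] (A : Arrangement K V) :
    ⊤ ∉ A.hyperplanes := fun h => A.ne_zero_of_ker_mem (α := 0) (by rwa [LinearMap.ker_zero]) rfl

theorem prod_top_ne_top_prod (A : Arrangement K V₁) {H₁ : Submodule K V₁}
    (h : H₁ ∈ A.hyperplanes) (H₂ : Submodule K V₂) :
    H₁.prod (⊤ : Submodule K V₂) ≠ (⊤ : Submodule K V₁).prod H₂ := by
  intro heq
  have : H₁ = ⊤ := by
    ext x
    simpa using SetLike.ext_iff.1 heq (x, 0)
  exact A.top_notMem (this ▸ h)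

theorem card_prod (A₁ : Arrangement K V₁) (A₂ : Arrangement K V₂) :
    (A₁.prod A₂).card = A₁.card + A₂.card := by
  rw [card_eq_ncard, card_eq_ncard, card_eq_ncard, ← Set.ncard_image_of_injective A₁.hyperplanes
    (prod_top_injective (V₂ := V₂)), ← Set.ncard_image_of_injective A₂.hyperplanes
    (top_prod_injective (V₁ := V₁))]
  refine Set.ncard_union_eq (Set.disjoint_left.2 ?_) (A₁.finite.image _) (A₂.finite.image _)
  rintro _ ⟨H₁, h₁, rfl⟩ ⟨H₂, h₂, heq⟩
  exact A₁.prod_top_ne_top_prod h₁ H₂ heq.symm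

theorem restrictDer_fst_mem (A₁ : Arrangement K V₁) (A₂ : Arrangement K V₂) {θ : Der K V₁}
    (hθ : θ ∈ A₁.derivations) :
    restrictDer (LinearMap.fst K V₁ V₂) (LinearMap.inl K V₁ V₂) θ ∈
      (A₁.prod A₂).derivations := by
  rw [mem_derivations_iff] at hθ ⊢
  rintro β (⟨H, hH, hk⟩ | ⟨H, hH, hk⟩)
  · have hker := A₁.ker_formOf hH
    refine form_dvd_der_of_ker_eq (α := formOf H ∘ₗ LinearMap.fst K V₁ V₂) ?_ ?_
    · rw [← hk, LinearMap.ker_comp, hker]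
      ext x
      simp
    · rw [restrictDer_form, LinearMap.comp_assoc, LinearMap.fst_comp_inl, LinearMap.comp_id,
        ← Poly.pullback_form]
      exact map_dvd _ (hθ _ (by rwa [hker]))
  · have hker := A₂.ker_formOf hH
    refine form_dvd_der_of_ker_eq (α := formOf H ∘ₗ LinearMap.snd K V₁ V₂) ?_ ?_
    · rw [← hk, LinearMap.ker_comp, hker]
      ext x
      simp
    · rw [restrictDer_form, LinearMap.comp_assoc, LinearMap.snd_comp_inl, LinearMap.comp_zero]
      simp

theorem restrictDer_snd_mem (A₁ : Arrangement K V₁) (A₂ : Arrangement K V₂) {θ : Der K V₂}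
    (hθ : θ ∈ A₂.derivations) :
    restrictDer (LinearMap.snd K V₁ V₂) (LinearMap.inr K V₁ V₂) θ ∈
      (A₁.prod A₂).derivations := by
  rw [mem_derivations_iff] at hθ ⊢
  rintro β (⟨H, hH, hk⟩ | ⟨H, hH, hk⟩)
  · have hker := A₁.ker_formOf hH
    refine form_dvd_der_of_ker_eq (α := formOf H ∘ₗ LinearMap.fst K V₁ V₂) ?_ ?_
    · rw [← hk, LinearMap.ker_comp, hker]
      ext x
      simp
    · rw [restrictDer_form, LinearMap.comp_assoc, LinearMap.fst_comp_inr, LinearMap.comp_zero]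
      simp
  · have hker := A₂.ker_formOf hH
    refine form_dvd_der_of_ker_eq (α := formOf H ∘ₗ LinearMap.snd K V₁ V₂) ?_ ?_
    · rw [← hk, LinearMap.ker_comp, hker]
      ext x
      simp
    · rw [restrictDer_form, LinearMap.comp_assoc, LinearMap.snd_comp_inr, LinearMap.comp_id,
        ← Poly.pullback_form]
      exact map_dvd _ (hθ _ (by rwa [hker]))

/-- Products of free arrangements are free. -/
theorem IsFree.prod [FiniteDimensional K V₁] [FiniteDimensional K V₂] {A₁ : Arrangement K V₁}
    {A₂ : Arrangement K V₂} (h₁ : A₁.IsFree) (h₂ : A₂.IsFree) : (A₁.prod A₂).IsFree := by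
  classical
  obtain ⟨e₁, h₁⟩ := h₁
  obtain ⟨e₂, h₂⟩ := h₂
  let b₁ := Module.finBasis K V₁
  let b₂ := Module.finBasis K V₂
  obtain ⟨θ, d, hd, rfl, hsum⟩ := h₁.exists_basis b₁
  obtain ⟨φ, a, ha, rfl, hsum'⟩ := h₂.exists_basis b₂
  let π₁ := LinearMap.fst K V₁ V₂
  let π₂ := LinearMap.snd K V₁ V₂
  let ψ : Fin (finrank K V₁) ⊕ Fin (finrank K V₂) → Der K (V₁ × V₂) :=
    Sum.elim (fun i => restrictDer π₁ (LinearMap.inl K V₁ V₂) (θ i))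
      (fun j => restrictDer π₂ (LinearMap.inr K V₁ V₂) (φ j))
  refine ⟨_, (A₁.prod A₂).isFreeWithExponents_of_sum_degrees_le (b₁.prod b₂) (θ := ψ)
    (d := Sum.elim d a) ?_ ?_ ?_ ?_⟩
  · rintro (i | j)
    · exact A₁.restrictDer_fst_mem A₂ (θ i).2
    · exact A₁.restrictDer_snd_mem A₂ (φ j).2
  · rintro (i | j)
    · exact (hd i).restrictDer _ _
    · exact (ha j).restrictDer _ _
  · have hc₁ : ∀ i, (b₁.prod b₂).coord (Sum.inl i) = b₁.coord i ∘ₗ π₁ := fun i => by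
      ext x <;> simp [π₁]
    have hc₂ : ∀ i, (b₁.prod b₂).coord (Sum.inr i) = b₂.coord i ∘ₗ π₂ := fun i => by
      ext x <;> simp [π₂]
    -- Each derivation is extended by zero on the other factor's forms, so the coefficient matrix is
    -- block diagonal.
    have hM : saitoMatrix (b₁.prod b₂) ψ = Matrix.fromBlocks
        ((saitoMatrix b₁ fun i => (θ i : Der K V₁)).map (Poly.pullback π₁)) 0 0
        ((saitoMatrix b₂ fun i => (φ i : Der K V₂)).map (Poly.pullback π₂)) := by
      ext (i | i) (j | j)
      · simp [ψ, hc₁, restrictDer_form, LinearMap.comp_assoc, π₁]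
      · simp [ψ, hc₂, restrictDer_form, LinearMap.comp_assoc, π₁, π₂]
      · simp [ψ, hc₁, restrictDer_form, LinearMap.comp_assoc, π₁, π₂]
      · simp [ψ, hc₂, restrictDer_form, LinearMap.comp_assoc, π₂]
    rw [← det_saitoMatrix_ne_zero_iff (b₁.prod b₂), hM, Matrix.det_fromBlocks_zero₂₁]
    have hdet₁ := (Poly.pullback π₁).map_det (saitoMatrix b₁ fun i => (θ i : Der K V₁))
    have hdet₂ := (Poly.pullback π₂).map_det (saitoMatrix b₂ fun i => (φ i : Der K V₂))
    rw [AlgHom.mapMatrix_apply] at hdet₁ hdet₂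
    rw [← hdet₁, ← hdet₂]
    refine mul_ne_zero ?_ ?_
    · rw [map_ne_zero_iff _ (Poly.pullback_injective (LinearMap.fst_comp_inl ..))]
      exact (det_saitoMatrix_ne_zero_iff b₁ _).2 (linearIndependent_coe_basis θ)
    · rw [map_ne_zero_iff _ (Poly.pullback_injective (LinearMap.snd_comp_inr ..))]
      exact (det_saitoMatrix_ne_zero_iff b₂ _).2 (linearIndependent_coe_basis φ)
  · rw [Fintype.sum_sum_type, card_prod]
    exact (congrArg₂ (· + ·) hsum hsum').le

end Product

end Arrangement

namespace Arrangement

/-! ### Localization as pushforward along a surjection -/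

section Push

variable {K : Type u} [Field K] {V W U : Type v} [AddCommGroup V] [Module K V]
  [AddCommGroup W] [Module K W] [AddCommGroup U] [Module K U]

open Module Polynomial

/-- The image in `W` of the localization of `A` at the kernel of the surjection `π : V → W`: the
hyperplanes of `W` whose preimage belongs to `A`. -/
def push (A : Arrangement K V) (π : V →ₗ[K] W) (hπ : Function.Surjective π) :
    Arrangement K W where
  hyperplanes := {H | H.comap π ∈ A.hyperplanes}
  finite := A.finite.preimage (Submodule.comap_injective_of_surjective hπ).injOn
  isHyperplane := fun H hH => by
    obtain ⟨α, hα, hk⟩ := A.isHyperplane _ hH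
    have hle : LinearMap.ker π ≤ LinearMap.ker α := hk ▸ LinearMap.ker_le_comap π
    obtain ⟨σ, hσ⟩ := π.exists_rightInverse_of_surjective (LinearMap.range_eq_top.2 hπ)
    have hcomp : (α ∘ₗ σ) ∘ₗ π = α := by
      ext x
      have : x - σ (π x) ∈ LinearMap.ker π := by
        have := LinearMap.congr_fun hσ (π x)
        simpa [sub_eq_zero] using this.symm
      have := hle this
      rw [LinearMap.mem_ker, map_sub, sub_eq_zero] at this
      exact this.symm
    refine ⟨α ∘ₗ σ, ?_, ?_⟩
    · intro h
      rw [h, LinearMap.zero_comp] at hcomp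
      exact hα hcomp.symm
    · refine Submodule.comap_injective_of_surjective hπ ?_
      rw [hk, ← LinearMap.ker_comp, hcomp]

theorem mem_push {A : Arrangement K V} {π : V →ₗ[K] W} {hπ : Function.Surjective π}
    {H : Submodule K W} : H ∈ (A.push π hπ).hyperplanes ↔ H.comap π ∈ A.hyperplanes := Iff.rfl

theorem push_push (A : Arrangement K V) (π : V →ₗ[K] W) (hπ : Function.Surjective π)
    (ρ : W →ₗ[K] U) (hρ : Function.Surjective ρ) :
    (A.push π hπ).push ρ hρ = A.push (ρ ∘ₗ π) (hρ.comp hπ) := rfl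

theorem card_push (A : Arrangement K V) (π : V →ₗ[K] W) (hπ : Function.Surjective π) :
    (A.push π hπ).card = {H ∈ A.hyperplanes | LinearMap.ker π ≤ H}.ncard := by
  rw [card_eq_ncard, ← Set.ncard_image_of_injective _
    (Submodule.comap_injective_of_surjective (f := π) hπ)]
  congr 1
  ext H
  constructor
  · rintro ⟨H', hH', rfl⟩
    exact ⟨hH', LinearMap.ker_le_comap π⟩
  · rintro ⟨hH, hle⟩
    have : (H.map π).comap π = H := by rwa [Submodule.comap_map_eq_self]
    exact ⟨H.map π, by rwa [mem_push, this], this⟩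

/-- Transport along an isomorphism; it ends the induction that splits off kernel vectors. -/
theorem IsFree.push_of_injective [FiniteDimensional K V] {A : Arrangement K V} (hA : A.IsFree)
    (π : V →ₗ[K] W) (hπ : Function.Surjective π) (hinj : Function.Injective π) :
    (A.push π hπ).IsFree := by
  classical
  obtain ⟨e, he⟩ := hA
  let E : V ≃ₗ[K] W := LinearEquiv.ofBijective π ⟨hinj, hπ⟩
  let σ : W →ₗ[K] V := E.symm.toLinearMap
  have hσπ : σ ∘ₗ π = LinearMap.id := LinearMap.ext fun x => E.symm_apply_apply x
  have hπσ : π ∘ₗ σ = LinearMap.id := LinearMap.ext fun x => E.apply_symm_apply x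
  let b := Module.finBasis K V
  obtain ⟨θ, d, hd, rfl, hsum⟩ := he.exists_basis b
  refine ⟨_, (A.push π hπ).isFreeWithExponents_of_sum_degrees_le (b.map E)
    (θ := fun i => restrictDer σ π (θ i)) (d := d) (fun i => ?_)
    (fun i => (hd i).restrictDer _ _) ?_ ?_⟩
  · rw [mem_derivations_iff]
    intro γ hγ
    have h1 : LinearMap.ker (γ ∘ₗ π) ∈ A.hyperplanes := by rwa [LinearMap.ker_comp]
    have h2 := map_dvd (Poly.pullback σ) ((A.mem_derivations_iff _).1 (θ i).2 _ h1)
    rwa [Poly.pullback_form, LinearMap.comp_assoc, hπσ, LinearMap.comp_id,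
      ← restrictDer_form] at h2
  · rw [← det_saitoMatrix_ne_zero_iff (b.map E)]
    have hM : saitoMatrix (b.map E) (fun i => restrictDer σ π (θ i)) =
        (saitoMatrix b fun i => (θ i : Der K V)).map (Poly.pullback σ) := by
      ext i j
      have : (b.map E).coord j ∘ₗ π = b.coord j := by
        ext x
        change b.repr (E.symm (π x)) j = b.repr x j
        rw [show E.symm (π x) = x from E.symm_apply_apply x]
      simp [restrictDer_form, this]
    have hdet := (Poly.pullback σ).map_det (saitoMatrix b fun i => (θ i : Der K V))
    rw [AlgHom.mapMatrix_apply] at hdet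
    rw [hM, ← hdet, map_ne_zero_iff _ (Poly.pullback_injective hσπ)]
    exact (det_saitoMatrix_ne_zero_iff b _).2 (linearIndependent_coe_basis θ)
  · rw [hsum, card_push, card_eq_ncard, LinearMap.ker_eq_bot.2 hinj]
    simp

end Push

/-! ### Freeness of localizations -/

section OneDimensionalKernel

open Module Polynomial

/-- The determinant is multilinear in the rows: expanding every row in powers of `X` makes its
coefficient at `T` a sum of determinants that take the coefficient `k r` from row `r`, with `∑ k r =
T`. -/
theorem exists_coeff_det_ne_zero {R : Type*} [CommRing R] {n : ℕ}
    (P : Matrix (Fin n) (Fin n) R[X]) {T : ℕ} (hT : P.det.coeff T ≠ 0) :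
    ∃ k : Fin n → ℕ, ∑ r, k r = T ∧
      (Matrix.of fun r j => (P r j).coeff (k r)).det ≠ 0 := by
  classical
  obtain ⟨N, hN⟩ : ∃ N, ∀ r j, (P r j).natDegree < N := by
    refine ⟨(Finset.univ.sup fun r => Finset.univ.sup fun j => (P r j).natDegree) + 1,
      fun r j => Nat.lt_succ_of_le ?_⟩
    exact (Finset.le_sup (f := fun j => (P r j).natDegree) (Finset.mem_univ j)).trans
      (Finset.le_sup (f := fun r => Finset.univ.sup fun j => (P r j).natDegree)
        (Finset.mem_univ r))
  have hP : P = fun r => ∑ k ∈ Finset.range N, (X ^ k : R[X]) • fun j => C ((P r j).coeff k) := by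
    funext r j
    conv_lhs => rw [(P r j).as_sum_range_C_mul_X_pow' (hN r j)]
    rw [Finset.sum_apply]
    exact Finset.sum_congr rfl fun k _ => mul_comm _ _
  have hdet : P.det = ∑ k ∈ Fintype.piFinset fun _ : Fin n => Finset.range N,
      X ^ (∑ r, k r) * C (Matrix.of fun r j => (P r j).coeff (k r)).det := by
    conv_lhs => rw [hP]
    refine (MultilinearMap.map_sum_finset (Matrix.detRowAlternating (R := R[X])).toMultilinearMap
      (fun r k => (X ^ k : R[X]) • fun j => C ((P r j).coeff k))
      (fun _ => Finset.range N)).trans (Finset.sum_congr rfl fun k _ => ?_)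
    rw [MultilinearMap.map_smul_univ, Finset.prod_pow_eq_pow_sum, smul_eq_mul, RingHom.map_det]
    rfl
  rw [hdet, finsetSum_coeff] at hT
  obtain ⟨k, -, hk⟩ := Finset.exists_ne_zero_of_sum_ne_zero hT
  rw [coeff_X_pow_mul', coeff_C] at hk
  refine ⟨k, ?_, ?_⟩
  · split_ifs at hk
    · omega
    · exact absurd rfl hk
    · exact absurd rfl hk
  · intro h0
    simp [h0] at hk

variable {K : Type u} [Field K] {V W : Type v} [AddCommGroup V] [Module K V]
  [AddCommGroup W] [Module K W]

/-- The algebra map `S(V*) → S(W*)[y]` given by a map `σ : W → V` and the direction `v`. -/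
noncomputable def expand (σ : W →ₗ[K] V) (v : V) : Poly K V →ₐ[K] (Poly K W)[X] :=
  Poly.lift
    { toFun := fun β => C (Poly.form K W (β ∘ₗ σ)) + C (algebraMap K (Poly K W) (β v)) * X
      map_add' := fun a b => by simp [LinearMap.add_comp, add_mul]; abel
      map_smul' := fun c a => by
        rw [LinearMap.smul_comp, map_smul, LinearMap.smul_apply, smul_eq_mul, map_mul,
          RingHom.id_apply, smul_add, Polynomial.smul_C, ← smul_mul_assoc, Polynomial.smul_C,
          Algebra.smul_def c (algebraMap K (Poly K W) (a v))] }

theorem expand_form (σ : W →ₗ[K] V) (v : V) (β : Dual K V) :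
    expand σ v (Poly.form K V β) =
      C (Poly.form K W (β ∘ₗ σ)) + C (algebraMap K (Poly K W) (β v)) * X :=
  Poly.lift_form _ _

/-- The bound `k ≤ p` is stated separately because `p - k` is truncated. -/
theorem coeff_expand (σ : W →ₗ[K] V) (v : V) {p : ℕ} {s : Poly K V}
    (hs : s ∈ homogeneousPart K V p) (k : ℕ) : ((expand σ v s).coeff k ≠ 0 → k ≤ p) ∧
      (expand σ v s).coeff k ∈ homogeneousPart K W (p - k) := by
  revert k
  refine Submodule.pow_induction_on_left' (LinearMap.range (Poly.form K V))
    (C := fun p s _ => ∀ k, ((expand σ v s).coeff k ≠ 0 → k ≤ p) ∧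
      (expand σ v s).coeff k ∈ homogeneousPart K W (p - k)) (fun r k => ?_)
    (fun x y p _ _ hx hy k => ?_) (fun m hm p x _ hx k => ?_) hs
  · rw [AlgHom.commutes, Polynomial.algebraMap_apply, coeff_C]
    split_ifs with hk
    · subst hk
      exact ⟨fun _ => le_rfl, algebraMap_mem_homogeneousPart r⟩
    · exact ⟨fun h => absurd rfl h, Submodule.zero_mem _⟩
  · rw [map_add, coeff_add]
    refine ⟨fun h => ?_, Submodule.add_mem _ (hx k).2 (hy k).2⟩
    by_contra hk
    refine h ?_
    rw [not_not.1 (mt (hx k).1 hk), not_not.1 (mt (hy k).1 hk), add_zero]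
  · obtain ⟨β, rfl⟩ := hm
    have hC : (expand σ v (Poly.form K V β * x)).coeff k =
        Poly.form K W (β ∘ₗ σ) * (expand σ v x).coeff k +
          β v • (X * expand σ v x).coeff k := by
      rw [map_mul, expand_form, add_mul, coeff_add, coeff_C_mul, mul_assoc, coeff_C_mul,
        Algebra.smul_def]
    rw [hC]
    have h1 : (Poly.form K W (β ∘ₗ σ) * (expand σ v x).coeff k ≠ 0 → k ≤ p + 1) ∧
        Poly.form K W (β ∘ₗ σ) * (expand σ v x).coeff k ∈ homogeneousPart K W (p + 1 - k) := by
      by_cases h0 : (expand σ v x).coeff k = 0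
      · rw [h0, mul_zero]
        exact ⟨fun h => absurd rfl h, Submodule.zero_mem _⟩
      · have hk := (hx k).1 h0
        refine ⟨fun _ => hk.trans (Nat.le_succ p), ?_⟩
        rw [show p + 1 - k = 1 + (p - k) by omega]
        exact mul_mem_homogeneousPart (form_mem_homogeneousPart _) (hx k).2
    have h2 : ((X * expand σ v x).coeff k ≠ 0 → k ≤ p + 1) ∧
        (X * expand σ v x).coeff k ∈ homogeneousPart K W (p + 1 - k) := by
      cases k with
      | zero =>
        rw [coeff_X_mul_zero]
        exact ⟨fun h => absurd rfl h, Submodule.zero_mem _⟩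
      | succ k =>
        rw [coeff_X_mul, Nat.add_sub_add_right]
        exact ⟨fun h => Nat.succ_le_succ ((hx k).1 h), (hx k).2⟩
    refine ⟨fun h => ?_, Submodule.add_mem _ h1.2 (Submodule.smul_mem _ _ h2.2)⟩
    by_contra hk
    refine h ?_
    rw [not_not.1 (mt h1.1 hk), not_not.1 (mt h2.1 hk), smul_zero, add_zero]

/-- The coefficient of `y ^ k` in a derivation of `S(V*)`, as a derivation of `S(W*)`. -/
noncomputable def coeffDer (σ : W →ₗ[K] V) (v : V) (π : V →ₗ[K] W) (k : ℕ) (θ : Der K V) :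
    Der K W :=
  mkDer
    { toFun := fun γ => (expand σ v (θ (Poly.form K V (γ ∘ₗ π)))).coeff k
      map_add' := fun γ δ => by simp [LinearMap.add_comp]
      map_smul' := fun c γ => by simp [LinearMap.smul_comp] }

theorem coeffDer_form (σ : W →ₗ[K] V) (v : V) (π : V →ₗ[K] W) (k : ℕ) (θ : Der K V)
    (γ : Dual K W) : coeffDer σ v π k θ (Poly.form K W γ) =
      (expand σ v (θ (Poly.form K V (γ ∘ₗ π)))).coeff k :=
  mkDer_form _ _

theorem IsHomogeneousDer.coeffDer {θ : Der K V} {d : ℕ} (h : IsHomogeneousDer θ d)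
    (σ : W →ₗ[K] V) (v : V) (π : V →ₗ[K] W) (k : ℕ) :
    IsHomogeneousDer (coeffDer σ v π k θ) (d - k) ∧ (coeffDer σ v π k θ ≠ 0 → k ≤ d) := by
  refine ⟨fun γ => ?_, fun h0 => ?_⟩
  · rw [coeffDer_form]
    exact (coeff_expand σ v (h _) k).2
  · by_contra hk
    refine h0 (der_ext fun γ => ?_)
    rw [coeffDer_form]
    exact not_not.1 (mt (coeff_expand σ v (h _) k).1 hk)

namespace IsHyperplaneSplitting

variable {y : Dual K V} {σ : W →ₗ[K] V} {π : V →ₗ[K] W} {v : V}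

theorem proj_vector (h : IsHyperplaneSplitting y σ π v) : π v = 0 := by
  have h1 := h.incl_proj v
  rw [h.form_vector, one_smul, sub_self] at h1
  rw [← h.proj_incl (π v), h1, map_zero]

theorem expand_form_comp (h : IsHyperplaneSplitting y σ π v) (γ : Dual K W) :
    expand σ v (Poly.form K V (γ ∘ₗ π)) = C (Poly.form K W γ) := by
  rw [expand_form, LinearMap.comp_assoc, show π ∘ₗ σ = LinearMap.id from LinearMap.ext h.proj_incl,
    LinearMap.comp_id, LinearMap.comp_apply, h.proj_vector, map_zero, map_zero, C_0, zero_mul,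
    add_zero]

/-- Forms coming from `W` do not involve `y`, so divisibility by them holds coefficient by
coefficient in `y`. -/
theorem coeffDer_mem (h : IsHyperplaneSplitting y σ π v) (hπ : Function.Surjective π)
    {A : Arrangement K V} {θ : Der K V} (hθ : θ ∈ A.derivations) (k : ℕ) :
    Arrangement.coeffDer σ v π k θ ∈ (A.push π hπ).derivations := by
  rw [mem_derivations_iff] at hθ ⊢
  intro γ hγ
  obtain ⟨t, ht⟩ := hθ (γ ∘ₗ π) (by rwa [LinearMap.ker_comp])
  rw [coeffDer_form, ht, map_mul, h.expand_form_comp, coeff_C_mul]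
  exact dvd_mul_right _ _

theorem expand_form_ne_zero (h : IsHyperplaneSplitting y σ π v) {α : Dual K V} (hα : α ≠ 0) :
    expand σ v (Poly.form K V α) ≠ 0 := by
  intro h0
  rw [expand_form] at h0
  have h1 : α ∘ₗ σ = 0 := by
    have := congrArg (fun f => f.coeff 0) h0
    simpa [Poly.form_eq_zero_iff] using this
  have h2 : α v = 0 := by
    have := congrArg (fun f => f.coeff 1) h0
    simpa [coeff_C] using this
  refine hα (LinearMap.ext fun x => ?_)
  have h3 := LinearMap.congr_fun h1 (π x)
  rw [LinearMap.comp_apply, h.incl_proj, map_sub, map_smul, h2, smul_zero, sub_zero] at h3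
  exact h3

theorem ker_proj_le_ker_iff (h : IsHyperplaneSplitting y σ π v) (α : Dual K V) :
    LinearMap.ker π ≤ LinearMap.ker α ↔ α v = 0 := by
  refine ⟨fun hle => hle h.proj_vector, fun hv x hx => ?_⟩
  have h1 := h.incl_proj x
  rw [LinearMap.mem_ker.1 hx, map_zero, eq_comm, sub_eq_zero] at h1
  rw [LinearMap.mem_ker, h1, map_smul, hv, smul_zero]

theorem _root_.Arrangement.natDegree_expand_form (σ : W →ₗ[K] V) (v : V) (α : Dual K V)
    [Decidable (α v = 0)] :
    (expand σ v (Poly.form K V α)).natDegree = if α v = 0 then 0 else 1 := by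
  rw [expand_form]
  split_ifs with h0
  · rw [h0, map_zero, C_0, zero_mul, add_zero, natDegree_C]
  · rw [add_comm]
    refine natDegree_linear ?_
    rwa [Ne, FaithfulSMul.algebraMap_eq_zero_iff]

/-- A form involves `y` exactly when its hyperplane does not contain `ker π`, i.e. is lost in the
localization. -/
theorem natDegree_expand_defPoly (h : IsHyperplaneSplitting y σ π v)
    (hπ : Function.Surjective π) (A : Arrangement K V) :
    (expand σ v A.defPoly).natDegree + (A.push π hπ).card = A.card := by
  classical
  have hn : ∀ H ∈ A.finite.toFinset, (expand σ v (Poly.form K V (formOf H))).natDegree =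
      if LinearMap.ker π ≤ H then 0 else 1 := by
    intro H hH
    rw [Set.Finite.mem_toFinset] at hH
    rw [natDegree_expand_form]
    refine if_congr ?_ rfl rfl
    rw [← h.ker_proj_le_ker_iff, A.ker_formOf hH]
  rw [defPoly, map_prod, natDegree_prod _ _ fun H hH => h.expand_form_ne_zero
    (A.formOf_ne_zero (A.finite.mem_toFinset.1 hH)), Finset.sum_congr rfl hn, card_push,
    show {H ∈ A.hyperplanes | LinearMap.ker π ≤ H} =
      ((A.finite.toFinset.filter fun H => LinearMap.ker π ≤ H : Finset _) : Set _) by ext; simp,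
    Set.ncard_coe_finset, Finset.card_filter, ← Finset.sum_add_distrib, card,
    Finset.card_eq_sum_ones]
  refine Finset.sum_congr rfl fun H _ => ?_
  split_ifs <;> rfl

/-- The basis of `V = K v ⊕ W` extending a basis of `W`. -/
noncomputable def basis (h : IsHyperplaneSplitting y σ π v) {n : ℕ} (w : Basis (Fin n) K W) :
    Basis (Fin (n + 1)) K V :=
  Basis.ofEquivFun
    { toFun := fun x => Fin.cons (y x) fun j => w.repr (π x) j
      map_add' := fun a b => by
        ext j
        refine Fin.cases ?_ (fun j => ?_) j <;> simp
      map_smul' := fun c a => by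
        ext j
        refine Fin.cases ?_ (fun j => ?_) j <;> simp
      invFun := fun c => c 0 • v + σ (∑ j, c (Fin.succ j) • w j)
      left_inv := fun x => by
        simp [Basis.sum_repr, h.incl_proj]
      right_inv := fun c => by
        ext j
        refine Fin.cases ?_ (fun j => ?_) j
        · simp [h.form_vector, h.form_incl]
        · simp [h.proj_vector, h.proj_incl, Finsupp.single_apply] }

theorem basis_coord_succ (h : IsHyperplaneSplitting y σ π v) {n : ℕ} (w : Basis (Fin n) K W)
    (j : Fin n) : (h.basis w).coord j.succ = w.coord j ∘ₗ π := by
  ext x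
  simp [basis]

/-- The `y`-degree of the determinant is `|A| - |A_X|`, where `A_X` is the localization. Removing
the `y`-column and one row, and then suitable powers of `y` from the remaining rows, leaves
independent elements of `D(A_X)` whose degrees are small enough for Saito's criterion. -/
theorem isFree_push (h : IsHyperplaneSplitting y σ π v) [FiniteDimensional K V]
    [FiniteDimensional K W] (hπ : Function.Surjective π) {A : Arrangement K V} (hA : A.IsFree) :
    (A.push π hπ).IsFree := by
  classical
  obtain ⟨e, he⟩ := hA
  let w := Module.finBasis K W
  let b := h.basis w
  obtain ⟨θ, d, hd, rfl, hsum⟩ := he.exists_basis b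
  let N := (saitoMatrix b fun i => (θ i : Der K V)).map (expand σ v)
  have hdet : expand σ v (saitoMatrix b fun i => (θ i : Der K V)).det = N.det :=
    (expand σ v).map_det _
  obtain ⟨u, hu⟩ := A.associated_det_defPoly b θ
  have hdegQ := h.natDegree_expand_defPoly hπ A
  have hQ0 : expand σ v A.defPoly ≠ 0 := by
    rw [defPoly, map_prod]
    exact Finset.prod_ne_zero_iff.2 fun H hH => h.expand_form_ne_zero
      (A.formOf_ne_zero (A.finite.mem_toFinset.1 hH))
  rw [← hu, map_mul, hdet] at hdegQ hQ0
  have hN0 : N.det ≠ 0 := left_ne_zero_of_mul hQ0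
  have hu1 := u.isUnit.map (expand σ v)
  rw [natDegree_mul hN0 hu1.ne_zero, natDegree_eq_zero_of_isUnit hu1, add_zero] at hdegQ
  -- In the Laplace expansion along the `y`-column, some term must have at least the `y`-degree of
  -- the whole determinant.
  obtain ⟨i, hi0, hi⟩ : ∃ i : Fin (finrank K W + 1),
      N i 0 * (N.submatrix i.succAbove Fin.succ).det ≠ 0 ∧
      N.det.natDegree ≤ (N i 0 * (N.submatrix i.succAbove Fin.succ).det).natDegree := by
    by_contra! hlt
    have hdeg : N.det.degree < (N.det.natDegree : WithBot ℕ) := by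
      generalize N.det.natDegree = D at hlt ⊢
      rw [← mem_degreeLT, Matrix.det_succ_column_zero]
      refine Submodule.sum_mem _ fun i _ => ?_
      rw [mul_assoc, show ((-1 : (Poly K W)[X]) ^ (i : ℕ)) = C ((-1) ^ (i : ℕ)) by simp,
        ← smul_eq_C_mul]
      refine Submodule.smul_mem _ _ ?_
      by_cases hi : N i 0 * (N.submatrix i.succAbove Fin.succ).det = 0
      · rw [hi]
        exact Submodule.zero_mem _
      · rw [mem_degreeLT, degree_eq_natDegree hi]
        exact_mod_cast hlt i hi
    rw [degree_eq_natDegree hN0] at hdeg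
    exact lt_irrefl _ hdeg
  rw [natDegree_mul (left_ne_zero_of_mul hi0) (right_ne_zero_of_mul hi0)] at hi
  have hrow : (N i 0).natDegree ≤ d i :=
    (coeff_expand σ v (hd i _) _).1 (leadingCoeff_ne_zero.2 (left_ne_zero_of_mul hi0))
  -- Taking the leading coefficient of the minor makes `∑ k r` its `y`-degree, which is at least
  -- `|A| - |A_X| - d i` by `hrow`.
  obtain ⟨k, hk, hkdet⟩ := exists_coeff_det_ne_zero (N.submatrix i.succAbove Fin.succ)
    (leadingCoeff_ne_zero.2 (right_ne_zero_of_mul hi0))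
  let ψ : Fin (finrank K W) → Der K W := fun r =>
    Arrangement.coeffDer σ v π (k r) (θ (i.succAbove r))
  have hψli : LinearIndependent (Poly K W) ψ := by
    rw [← det_saitoMatrix_ne_zero_iff w]
    convert hkdet using 2
    ext r j
    simp only [ψ, N, saitoMatrix_apply, Matrix.of_apply, Matrix.submatrix_apply, Matrix.map_apply,
      coeffDer_form]
    rw [h.basis_coord_succ]
  have hkd : ∀ r, k r ≤ d (i.succAbove r) := fun r =>
    ((hd _).coeffDer σ v π (k r)).2 (hψli.ne_zero r)
  refine ⟨_, (A.push π hπ).isFreeWithExponents_of_sum_degrees_le w (θ := ψ)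
    (d := fun r => d (i.succAbove r) - k r) (fun r => h.coeffDer_mem hπ (θ _).2 _)
    (fun r => ((hd _).coeffDer σ v π (k r)).1) hψli ?_⟩
  have h1 : ∑ r, (d (i.succAbove r) - k r) + ∑ r, k r = ∑ r, d (i.succAbove r) := by
    rw [← Finset.sum_add_distrib]
    exact Finset.sum_congr rfl fun r _ => Nat.sub_add_cancel (hkd r)
  rw [Fin.sum_univ_succAbove d i] at hsum
  omega

end IsHyperplaneSplitting

/-- Localizations of free arrangements are free. -/
theorem IsFree.push [FiniteDimensional K V] {A : Arrangement K V} (hA : A.IsFree)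
    (π : V →ₗ[K] W) (hπ : Function.Surjective π) : (A.push π hπ).IsFree := by
  induction hn : finrank K V generalizing V with
  | zero =>
    have := (finrank_zero_iff (R := K) (M := V)).1 hn
    exact hA.push_of_injective π hπ (Function.injective_of_subsingleton _)
  | succ n ih =>
    by_cases hinj : Function.Injective π
    · exact hA.push_of_injective π hπ hinj
    obtain ⟨x, hx, hx0⟩ : ∃ x ∈ LinearMap.ker π, x ≠ 0 := by
      rw [← LinearMap.ker_eq_bot] at hinj
      exact Submodule.exists_mem_ne_zero_of_ne_bot hinj
    obtain ⟨y, hy⟩ : ∃ y : Dual K V, y x ≠ 0 := by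
      by_contra! h
      exact hx0 ((Module.forall_dual_apply_eq_zero_iff K x).1 h)
    -- Split off the line of one kernel vector `x`; then `π` factors through the projection onto the
    -- hyperplane `ker y'`, of smaller dimension.
    let y' : Dual K V := (y x)⁻¹ • y
    have hy' : y' x = 1 := by simp [y', hy]
    have hy'0 : y' ≠ 0 := fun h => by simp [h] at hy'
    let τ : V →ₗ[K] LinearMap.ker y' := LinearMap.codRestrict _ (LinearMap.id - y'.smulRight x)
      fun z => by simp [hy']
    have hτ : ∀ z, (τ z : V) = z - y' z • x := fun z => rfl
    have hs : IsHyperplaneSplitting y' (LinearMap.ker y').subtype τ x :=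
      ⟨hy', fun z => z.2, fun z => Subtype.ext (by
        rw [hτ]
        change (z : V) - y' z • x = z
        rw [LinearMap.mem_ker.1 z.2, zero_smul, sub_zero]), hτ⟩
    have hτs : Function.Surjective τ := fun z => ⟨z, hs.proj_incl z⟩
    have hcomp : (π ∘ₗ (LinearMap.ker y').subtype) ∘ₗ τ = π := by
      ext z
      simp [hτ, LinearMap.mem_ker.1 hx]
    have hρ : Function.Surjective (π ∘ₗ (LinearMap.ker y').subtype) := by
      refine Function.Surjective.of_comp (g := τ) ?_
      rw [← LinearMap.coe_comp, hcomp]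
      exact hπ
    have h1 := ih (hs.isFree_push hτs hA) (π ∘ₗ (LinearMap.ker y').subtype) hρ
      (by have := Dual.finrank_ker_add_one_of_ne_zero hy'0; omega)
    rw [push_push] at h1
    convert h1 using 1
    congr 1
    exact hcomp.symm

end OneDimensionalKernel

end Arrangement

namespace Arrangement

/-! ### Localizations of recursively free arrangements -/

section RecursivelyFree

variable {K : Type u} [Field K] {V W : Type v} [AddCommGroup V] [Module K V]
  [AddCommGroup W] [Module K W]

open Module

theorem isFree_empty [FiniteDimensional K V] : (empty K V).IsFree := by
  classical
  let b := Module.finBasis K V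
  refine ⟨_, (empty K V).isFreeWithExponents_of_sum_degrees_le b
    (θ := fun i => (derEquiv b).symm (Pi.single i 1)) (d := fun _ => 0)
    (fun i => ?_) (fun i α => ?_) ?_ (by simp)⟩
  · rw [mem_derivations_iff]
    rintro α ⟨⟩
  · rw [derEquiv_symm_form]
    refine Submodule.sum_mem _ fun j _ => Submodule.smul_mem _ _ ?_
    by_cases h : j = i
    · subst h
      rw [Pi.single_eq_same]
      exact one_mem_homogeneousPart
    · rw [Pi.single_eq_of_ne h]
      exact Submodule.zero_mem _
  · rw [← det_saitoMatrix_ne_zero_iff b]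
    have : saitoMatrix b (fun i => (derEquiv b).symm (Pi.single i (1 : Poly K V))) = 1 := by
      ext i j : 2
      simp [saitoMatrix, Matrix.one_apply, Pi.single_apply, eq_comm]
    rw [this, Matrix.det_one]
    exact one_ne_zero

theorem IsRecursivelyFree.finiteDimensional {A : Arrangement K V} (h : A.IsRecursivelyFree) :
    FiniteDimensional K V := by
  cases h <;> assumption

theorem IsRecursivelyFree.isFree {A : Arrangement K V} (h : A.IsRecursivelyFree) : A.IsFree := by
  induction h with
  | empty => exact isFree_empty
  | addition A H hH _ _ hexp => exact A.isFree_of_addition hH hexp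
  | deletion A H hH _ _ hexp => exact A.isFree_of_deletion hH hexp

theorem push_deletion_of_not_le (A : Arrangement K V) {H : Submodule K V} (π : V →ₗ[K] W)
    (hπ : Function.Surjective π) (h : ¬ LinearMap.ker π ≤ H) :
    (A.deletion H).push π hπ = A.push π hπ := by
  ext H'
  refine ⟨fun h' => h'.1, fun h' => ⟨h', fun heq => h ?_⟩⟩
  rw [← Set.mem_singleton_iff.1 heq]
  exact LinearMap.ker_le_comap π

theorem push_deletion (A : Arrangement K V) (π : V →ₗ[K] W) (hπ : Function.Surjective π)
    (L : Submodule K W) :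
    (A.deletion (L.comap π)).push π hπ = (A.push π hπ).deletion L := by
  ext H'
  refine and_congr Iff.rfl (not_congr ?_)
  exact (Submodule.comap_injective_of_surjective hπ).eq_iff

/-- The restriction of a surjection `V → W` to the preimage of a subspace. -/
def comapMap (π : V →ₗ[K] W) (L : Submodule K W) : L.comap π →ₗ[K] L :=
  π.restrict fun _ h => h

theorem comapMap_surjective {π : V →ₗ[K] W} (hπ : Function.Surjective π) (L : Submodule K W) :
    Function.Surjective (comapMap π L) := by
  rintro ⟨y, hy⟩
  obtain ⟨x, rfl⟩ := hπ y
  exact ⟨⟨x, hy⟩, rfl⟩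

theorem push_restriction (A : Arrangement K V) (π : V →ₗ[K] W) (hπ : Function.Surjective π)
    (L : Submodule K W) :
    (A.restriction (L.comap π)).push (comapMap π L) (comapMap_surjective hπ L) =
      (A.push π hπ).restriction L := by
  have hcomap : ∀ M : Submodule K W, (M.comap π).comap (L.comap π).subtype =
      (M.comap L.subtype).comap (comapMap π L) := fun _ => rfl
  ext Y
  constructor
  · rintro ⟨H', ⟨hH', hle⟩, heq⟩
    -- The trace of `H'` is a preimage under `comapMap π L`, so it contains `ker π`, which lies in
    -- `L.comap π`.
    have hker : LinearMap.ker π ≤ H' := by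
      intro x hx
      have hxL : x ∈ L.comap π := LinearMap.ker_le_comap π hx
      have h0 : comapMap π L ⟨x, hxL⟩ = 0 := Subtype.ext hx
      have : (⟨x, hxL⟩ : L.comap π) ∈ Y.comap (comapMap π L) := by
        rw [Submodule.mem_comap, h0]
        exact Y.zero_mem
      rw [← heq] at this
      exact this
    have hH'' : (H'.map π).comap π = H' := by rwa [Submodule.comap_map_eq_self]
    refine ⟨H'.map π, ⟨?_, fun h => hle ?_⟩, ?_⟩
    · rwa [mem_push, hH'']
    · rw [← hH'']
      exact Submodule.comap_mono h
    · refine Submodule.comap_injective_of_surjective (comapMap_surjective hπ L) ?_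
      change ((H'.map π).comap L.subtype).comap (comapMap π L) = _
      rw [← hcomap, hH'']
      exact heq
  · rintro ⟨M, ⟨hM, hle⟩, rfl⟩
    refine ⟨M.comap π, ⟨hM, fun h => hle fun y hy => ?_⟩, hcomap M⟩
    obtain ⟨x, rfl⟩ := hπ y
    exact h hy

/-- Localizations of recursively free arrangements are recursively free. -/
theorem IsRecursivelyFree.push {A : Arrangement K V} (hA : A.IsRecursivelyFree)
    {W : Type v} [AddCommGroup W] [Module K W] (π : V →ₗ[K] W) (hπ : Function.Surjective π) :
    (A.push π hπ).IsRecursivelyFree := by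
  induction hA generalizing W with
  | empty =>
    have : FiniteDimensional K W := Module.Finite.of_surjective π hπ
    exact IsRecursivelyFree.empty
  | @addition V _ _ _ A H hH hdel hres hexp ihdel ihres =>
    have : FiniteDimensional K W := Module.Finite.of_surjective π hπ
    by_cases hle : LinearMap.ker π ≤ H
    · obtain ⟨L, rfl⟩ : ∃ L : Submodule K W, L.comap π = H :=
        ⟨H.map π, by rwa [Submodule.comap_map_eq_self]⟩
      have h1 := ihdel π hπ
      have h2 := ihres (comapMap π L) (comapMap_surjective hπ L)
      rw [push_deletion] at h1
      rw [A.push_restriction π hπ L] at h2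
      -- The inclusion of exponents is not localized but rederived from the freeness of both
      -- localizations.
      exact .addition _ L hH h1 h2 ((A.push π hπ).exponentsSubset_of_isFree hH
        ((A.isFree_of_addition hH hexp).push π hπ) h1.isFree).1
    · rw [← A.push_deletion_of_not_le π hπ hle]
      exact ihdel π hπ
  | @deletion V _ _ _ A H hH hA hres hexp ihA ihres =>
    have : FiniteDimensional K W := Module.Finite.of_surjective π hπ
    by_cases hle : LinearMap.ker π ≤ H
    · obtain ⟨L, rfl⟩ : ∃ L : Submodule K W, L.comap π = H :=
        ⟨H.map π, by rwa [Submodule.comap_map_eq_self]⟩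
      have h1 := ihA π hπ
      have h2 := ihres (comapMap π L) (comapMap_surjective hπ L)
      have h3 := (A.isFree_of_deletion hH hexp).push π hπ
      rw [push_deletion] at h3 ⊢
      rw [A.push_restriction π hπ L] at h2
      exact .deletion _ L hH h1 h2 ((A.push π hπ).exponentsSubset_of_isFree hH h1.isFree h3).2
    · rw [A.push_deletion_of_not_le π hπ hle]
      exact ihA π hπ

end RecursivelyFree

/-! ### Products of recursively free arrangements -/

section Product

variable {K : Type u} [Field K] {V₁ V₂ : Type v} [AddCommGroup V₁] [Module K V₁]
  [AddCommGroup V₂] [Module K V₂]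

open Module

theorem push_fst_prod (A₁ : Arrangement K V₁) (A₂ : Arrangement K V₂) :
    (A₁.prod A₂).push (LinearMap.fst K V₁ V₂) LinearMap.fst_surjective = A₁ := by
  have hcomap : ∀ H : Submodule K V₁, H.comap (LinearMap.fst K V₁ V₂) = H.prod ⊤ := fun H => by
    ext x
    simp
  ext H
  rw [mem_push, hcomap]
  constructor
  · rintro (⟨H₁, h₁, heq⟩ | ⟨H₂, h₂, heq⟩)
    · rwa [← prod_top_injective heq]
    · have : H₂ = ⊤ := by
        ext x
        simpa using SetLike.ext_iff.1 heq (0, x)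
      exact absurd (this ▸ h₂) A₂.top_notMem
  · exact fun h => Or.inl ⟨H, h, rfl⟩

theorem push_snd_prod (A₁ : Arrangement K V₁) (A₂ : Arrangement K V₂) :
    (A₁.prod A₂).push (LinearMap.snd K V₁ V₂) LinearMap.snd_surjective = A₂ := by
  have hcomap : ∀ H : Submodule K V₂, H.comap (LinearMap.snd K V₁ V₂) =
      (⊤ : Submodule K V₁).prod H := fun H => by
    ext x
    simp
  ext H
  rw [mem_push, hcomap]
  constructor
  · rintro (⟨H₁, h₁, heq⟩ | ⟨H₂, h₂, heq⟩)
    · exact absurd heq (A₁.prod_top_ne_top_prod h₁ H)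
    · rwa [← top_prod_injective heq]
  · exact fun h => Or.inr ⟨H, h, rfl⟩

theorem deletion_prod (A₁ : Arrangement K V₁) (A₂ : Arrangement K V₂) {H : Submodule K V₁}
    (hH : H ∈ A₁.hyperplanes) :
    (A₁.prod A₂).deletion (H.prod ⊤) = (A₁.deletion H).prod A₂ := by
  ext H'
  constructor
  · rintro ⟨⟨H₁, h₁, rfl⟩ | ⟨H₂, h₂, rfl⟩, hne⟩
    · exact Or.inl ⟨H₁, ⟨h₁, fun h => hne (by rw [Set.mem_singleton_iff.1 h]; rfl)⟩, rfl⟩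
    · exact Or.inr ⟨H₂, h₂, rfl⟩
  · rintro (⟨H₁, ⟨h₁, hne⟩, rfl⟩ | ⟨H₂, h₂, rfl⟩)
    · exact ⟨Or.inl ⟨H₁, h₁, rfl⟩, fun h => hne (prod_top_injective h)⟩
    · exact ⟨Or.inr ⟨H₂, h₂, rfl⟩, fun h => A₁.prod_top_ne_top_prod hH H₂ h.symm⟩

/-- The product of a subspace of `V₁` and `V₂`, as a subspace of `V₁ × V₂`. -/
def toProdTop (H : Submodule K V₁) : H × V₂ →ₗ[K] H.prod (⊤ : Submodule K V₂) :=
  LinearMap.codRestrict _ (H.subtype.prodMap LinearMap.id) fun x => ⟨x.1.2, trivial⟩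

theorem toProdTop_surjective (H : Submodule K V₁) :
    Function.Surjective (toProdTop (V₂ := V₂) H) := by
  rintro ⟨⟨x, y⟩, hx, -⟩
  exact ⟨(⟨x, hx⟩, y), rfl⟩

/-- The restriction lives on the subspace `H.prod ⊤` and the product on the type `H × V₂`; the
`push` along their isomorphism identifies the two. -/
theorem restriction_prod (A₁ : Arrangement K V₁) (A₂ : Arrangement K V₂) {H : Submodule K V₁} :
    (A₁.prod A₂).restriction (H.prod ⊤) =
      ((A₁.restriction H).prod A₂).push (toProdTop H) (toProdTop_surjective H) := by
  have hc₁ : ∀ H₁ : Submodule K V₁,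
      ((H₁.prod (⊤ : Submodule K V₂)).comap (H.prod ⊤).subtype).comap (toProdTop H) =
        (H₁.comap H.subtype).prod ⊤ := fun H₁ => by
    ext x
    exact Iff.rfl
  have hc₂ : ∀ H₂ : Submodule K V₂,
      (((⊤ : Submodule K V₁).prod H₂).comap (H.prod ⊤).subtype).comap (toProdTop H) =
        (⊤ : Submodule K H).prod H₂ := fun H₂ => by
    ext x
    exact Iff.rfl
  have hinj := Submodule.comap_injective_of_surjective (toProdTop_surjective (V₂ := V₂) H)
  ext Y
  rw [mem_push]
  constructor
  · rintro ⟨_, ⟨⟨H₁, h₁, rfl⟩ | ⟨H₂, h₂, rfl⟩, hle⟩, rfl⟩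
    · refine Or.inl ⟨_, ⟨H₁, ⟨h₁, fun h => hle (Submodule.prod_mono h le_rfl)⟩, rfl⟩, ?_⟩
      exact (hc₁ H₁).symm
    · exact Or.inr ⟨H₂, h₂, (hc₂ H₂).symm⟩
  · rintro (⟨_, ⟨H₁, ⟨h₁, hle⟩, rfl⟩, heq⟩ | ⟨H₂, h₂, heq⟩)
    · refine ⟨H₁.prod ⊤, ⟨Or.inl ⟨H₁, h₁, rfl⟩, fun h => hle fun x hx => ?_⟩, ?_⟩
      · exact (h (show (x, (0 : V₂)) ∈ H.prod ⊤ from ⟨hx, trivial⟩)).1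
      · exact hinj ((hc₁ H₁).trans heq)
    · refine ⟨(⊤ : Submodule K V₁).prod H₂, ⟨Or.inr ⟨H₂, h₂, rfl⟩, fun h => ?_⟩, ?_⟩
      · refine A₂.top_notMem ((?_ : H₂ = ⊤) ▸ h₂)
        rw [eq_top_iff]
        intro y _
        exact (h (show ((0 : V₁), y) ∈ H.prod ⊤ from ⟨H.zero_mem, trivial⟩)).2
      · exact hinj ((hc₂ H₂).trans heq)

/-- Induction on `A₁` multiplies each triple by `A₂`; exponents are again recovered from the
freeness of the products. Only freeness of `A₂` is needed apart from the base case, which is left as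
a hypothesis so that the lemma can be used for either factor. -/
theorem IsRecursivelyFree.prod_of_empty_prod [FiniteDimensional K V₂] {A₁ : Arrangement K V₁}
    {A₂ : Arrangement K V₂} (h₁ : A₁.IsRecursivelyFree) (h₂ : A₂.IsFree)
    (hempty : ∀ (V : Type v) [AddCommGroup V] [Module K V] [FiniteDimensional K V],
      ((Arrangement.empty K V).prod A₂).IsRecursivelyFree) : (A₁.prod A₂).IsRecursivelyFree := by
  induction h₁ with
  | @empty V => exact hempty V
  | @addition V _ _ _ A H hH hdel hres hexp ihdel ihres =>
    have hmem : H.prod ⊤ ∈ (A.prod A₂).hyperplanes := Or.inl ⟨H, hH, rfl⟩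
    have h1 : ((A.prod A₂).deletion (H.prod ⊤)).IsRecursivelyFree := by
      rwa [deletion_prod A A₂ hH]
    refine .addition _ (H.prod ⊤) hmem h1 ?_ ((A.prod A₂).exponentsSubset_of_isFree hmem
      ((A.isFree_of_addition hH hexp).prod h₂) h1.isFree).1
    rw [restriction_prod]
    exact ihres.push _ _
  | @deletion V _ _ _ A H hH hA hres hexp ihA ihres =>
    have hmem : H.prod ⊤ ∈ (A.prod A₂).hyperplanes := Or.inl ⟨H, hH, rfl⟩
    rw [← deletion_prod A A₂ hH]
    refine .deletion _ (H.prod ⊤) hmem ihA ?_ ((A.prod A₂).exponentsSubset_of_isFree hmem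
      ihA.isFree ?_).2
    · rw [restriction_prod]
      exact ihres.push _ _
    · rw [deletion_prod A A₂ hH]
      exact (A.isFree_of_deletion hH hexp).prod h₂

theorem empty_prod_empty : (empty K V₁).prod (empty K V₂) = empty K (V₁ × V₂) := by
  ext H
  constructor
  · rintro (⟨_, ⟨⟩, _⟩ | ⟨_, ⟨⟩, _⟩)
  · rintro ⟨⟩

theorem swap_surjective : Function.Surjective
    (LinearMap.prod (LinearMap.snd K V₁ V₂) (LinearMap.fst K V₁ V₂)) := fun x =>
  ⟨(x.2, x.1), rfl⟩

theorem push_swap_prod (A₁ : Arrangement K V₁) (A₂ : Arrangement K V₂) :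
    (A₁.prod A₂).push (LinearMap.prod (LinearMap.snd K V₁ V₂) (LinearMap.fst K V₁ V₂))
      swap_surjective = A₂.prod A₁ := by
  have hc₁ : ∀ H₁ : Submodule K V₁, ((⊤ : Submodule K V₂).prod H₁).comap
      (LinearMap.prod (LinearMap.snd K V₁ V₂) (LinearMap.fst K V₁ V₂)) = H₁.prod ⊤ := fun H₁ => by
    ext x
    simp
  have hc₂ : ∀ H₂ : Submodule K V₂, (H₂.prod (⊤ : Submodule K V₁)).comap
      (LinearMap.prod (LinearMap.snd K V₁ V₂) (LinearMap.fst K V₁ V₂)) =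
        (⊤ : Submodule K V₁).prod H₂ := fun H₂ => by
    ext x
    simp
  have hinj := Submodule.comap_injective_of_surjective (swap_surjective (K := K) (V₁ := V₁)
    (V₂ := V₂))
  ext H
  rw [mem_push]
  constructor
  · rintro (⟨H₁, h₁, heq⟩ | ⟨H₂, h₂, heq⟩)
    · exact Or.inr ⟨H₁, h₁, hinj ((hc₁ H₁).trans heq)⟩
    · exact Or.inl ⟨H₂, h₂, hinj ((hc₂ H₂).trans heq)⟩
  · rintro (⟨H₂, h₂, rfl⟩ | ⟨H₁, h₁, rfl⟩)
    · exact Or.inr ⟨H₂, h₂, (hc₂ H₂).symm⟩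
    · exact Or.inl ⟨H₁, h₁, (hc₁ H₁).symm⟩

theorem IsRecursivelyFree.prod {A₁ : Arrangement K V₁} {A₂ : Arrangement K V₂}
    (h₁ : A₁.IsRecursivelyFree) (h₂ : A₂.IsRecursivelyFree) :
    (A₁.prod A₂).IsRecursivelyFree := by
  have := h₂.finiteDimensional
  refine h₁.prod_of_empty_prod h₂.isFree fun V _ _ _ => ?_
  -- The base case is the same lemma with `A₂` as first factor, whose own base case is an empty
  -- arrangement.
  have h : (A₂.prod (Arrangement.empty K V)).IsRecursivelyFree :=
    h₂.prod_of_empty_prod isFree_empty fun W _ _ _ => by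
      rw [empty_prod_empty]
      exact .empty
  rw [← push_swap_prod]
  exact h.push _ _

end Product

end Arrangement

theorem theorem1p2 {K : Type u} [Field K]
    {V₁ V₂ : Type v} [AddCommGroup V₁] [Module K V₁] [FiniteDimensional K V₁]
    [AddCommGroup V₂] [Module K V₂] [FiniteDimensional K V₂]
    (A₁ : Arrangement K V₁) (A₂ : Arrangement K V₂) :
    (A₁.prod A₂).IsRecursivelyFree ↔ A₁.IsRecursivelyFree ∧ A₂.IsRecursivelyFree := by
  refine ⟨fun h => ⟨?_, ?_⟩, fun h => h.1.prod h.2⟩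
  · rw [← A₁.push_fst_prod A₂]
    exact h.push _ _
  · rw [← A₁.push_snd_prod A₂]
    exact h.push _ _
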